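/- Let $\mathfrak H=\{\tau\in\mathbb C:\operatorname{Im}\tau>0\}$, $q=e^{2\pi i\tau}$, $\rho=e^{2\pi i/3}$, $\eta(\tau)=q^{1/24}\prod_{k\ge1}(1-q^k)$, $E_4=1+240\sum_{k\ge1}\sigma_3(k)q^k$ and $J=E_4^3/(1728\,\eta^{24})$. Let $n\ge 0$ be an integer and let $x_1,\dots,x_n\in(0,1)$ be pairwise distinct and satisfy the algebraic system $E^n_{8,3,12}$: $$\frac{8}{x_i}+\frac{3}{x_i-1}+\sum_{j\ne i}\frac{12}{x_i-x_j}=0,\qquad 1\le i\le n .$$ Let $w_1,\dots,w_n\in\mathfrak H$ with $J(w_i)=x_i$. Then $$f_n=\frac{\eta^{20}}{E_4^2\prod_{i=1}^n(J-x_i)^2}$$ is a meromorphic modular form of weight $2$ for $\mathrm{SL}_2(\mathbb Z)$ with a character, bounded as $\operatorname{Im}\tau\to\infty$. It has double poles with zero residue at $\rho$, at each $w_i$ and at all points of $\mathfrak H$ that are $\mathrm{SL}_2(\mathbb Z)$-equivalent to one of these, and it is holomorphic and nonvanishing at all other points of $\mathfrak H$. Moreover, the integral $h_n(\tau)=\int_i^\tau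 f_n(z)\,dz$, taken along paths in $\mathfrak H$ avoiding the poles of $f_n$, is independent of the path and is a meromorphic function on $\mathfrak H$ with $h_n'=f_n$, and its Schwarz derivative $\{h_n,\tau\}=\left(h_n''/h_n'\right)'-\frac12\left(h_n''/h_n'\right)^2$ satisfies $$\{h_n,\tau\}=2\pi^2\left(\frac{12n+5}{6}\right)^2E_4(\tau)$$ on $\mathfrak H$ (off the poles of $h_n$, and at the poles by continuous extension). -/

import Mathlib

open scoped MatrixGroups Topology

noncomputable section

namespace ModularSchwarz

open Filter UpperHalfPlane

/-- The Eisenstein series `E₄`, as a function of a complex variable in the upper half-plane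
(its values off the upper half-plane are irrelevant). -/
def E4 (z : ℂ) : ℂ := ModularForm.E₄ (UpperHalfPlane.ofComplex z)

/-- The elliptic modular function `J = E₄³ / (1728 Δ)` with `Δ = η²⁴`, normalised by
`J(i) = 1`, `J(ρ) = 0`. -/
def J (z : ℂ) : ℂ := E4 z ^ 3 / (1728 * ModularForm.eta z ^ 24)

/-- `x` is a solution of the algebraic system
`a / xᵢ + b / (xᵢ - 1) + ∑_{j ≠ i} c / (xᵢ - xⱼ) = 0`, `i = 1, …, n`.
That no denominator vanishes is part of being a solution. -/
structure IsSolution (a b c : ℝ) {n : ℕ} (x : Fin n → ℝ) : Prop where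
  ne_zero : ∀ i, x i ≠ 0
  ne_one : ∀ i, x i ≠ 1
  ne_of_ne : ∀ i j, i ≠ j → x i ≠ x j
  eq_zero : ∀ i,
    a / x i + b / (x i - 1) + ∑ j ∈ Finset.univ.erase i, c / (x i - x j) = 0

/-- `f = η²⁰ / (E₄² ∏ᵢ (J - xᵢ)²)`. -/
def f {n : ℕ} (x : Fin n → ℝ) (z : ℂ) : ℂ :=
  ModularForm.eta z ^ 20 / (E4 z ^ 2 * ∏ i, (J z - (x i : ℂ)) ^ 2)

/-- `g` is a meromorphic modular form of weight `k` for `SL₂(ℤ)` with character `χ`: it is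
meromorphic on the upper half-plane, satisfies `g(γτ) = χ(γ) (cτ + d)ᵏ g(τ)`, and is meromorphic
at the cusp, i.e. a meromorphic function of `exp(2πiτ/N)` at `0` for some `N`. -/
structure IsMeromorphicModularForm (k : ℤ) (χ : SL(2, ℤ) →* ℂˣ) (g : ℂ → ℂ) : Prop where
  meromorphic : ∀ τ : ℍ, MeromorphicAt g (τ : ℂ)
  transform : ∀ (γ : SL(2, ℤ)) (τ : ℍ),
    g ((γ • τ : ℍ) : ℂ) = (χ γ : ℂ) * denom (γ : GL (Fin 2) ℝ) τ ^ k * g (τ : ℂ)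
  cusp : ∃ N : ℕ, 0 < N ∧ ∃ F : ℂ → ℂ, MeromorphicAt F 0 ∧
    ∀ᶠ τ : ℍ in atImInfty, g (τ : ℂ) = F (Complex.exp (2 * Real.pi * Complex.I * τ / N))

/-- `g` has residue `v` at `p`: the integral of `g` over all sufficiently small circles around `p`,
divided by `2πi`, is `v`. (Used for `g` meromorphic at `p`.) -/
def HasResidueAt (g : ℂ → ℂ) (p v : ℂ) : Prop :=
  ∀ᶠ r : ℝ in 𝓝[>] 0, (2 * Real.pi * Complex.I)⁻¹ * (∮ z in C(p, r), g z) = v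

/-- `γ : [0, 1] → U` is a continuously differentiable path in `U` from `a` to `b`. -/
structure IsC1Path (U : Set ℂ) (a b : ℂ) (γ : ℝ → ℂ) : Prop where
  contDiff : ContDiff ℝ 1 γ
  source : γ 0 = a
  target : γ 1 = b
  mem : ∀ t ∈ Set.Icc (0 : ℝ) 1, γ t ∈ U

/-- `v` is the value of `∫_a^b g(z) dz` taken within `U`: there are paths from `a` to `b` in `U`,
and the integral of `g` along every one of them is `v`. -/
def IsPathIntegral (g : ℂ → ℂ) (U : Set ℂ) (a b v : ℂ) : Prop :=
  (∃ γ, IsC1Path U a b γ) ∧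
    ∀ γ, IsC1Path U a b γ → ∫ t in (0 : ℝ)..1, g (γ t) * deriv γ t = v

open Classical in
/-- The function `b ↦ ∫_a^b g(z) dz` on `U`; its value is `0` where the integral does not exist. -/
def pathIntegral (g : ℂ → ℂ) (U : Set ℂ) (a b : ℂ) : ℂ :=
  if h : ∃ v, IsPathIntegral g U a b v then h.choose else 0

/-- The points of the upper half-plane at which `g` is holomorphic. -/
def regularSet (g : ℂ → ℂ) : Set ℂ := {z | 0 < z.im ∧ AnalyticAt ℂ g z}

/-- `h(τ) = ∫_i^τ f(z) dz`, the integral being taken along paths in the upper half-plane that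
avoid the poles of `f`. -/
def h {n : ℕ} (x : Fin n → ℝ) : ℂ → ℂ := pathIntegral (f x) (regularSet (f x)) Complex.I

/-- The Schwarz derivative `{u, τ} = (u''/u')' - (1/2) (u''/u')²`. -/
def schwarz (u : ℂ → ℂ) (τ : ℂ) : ℂ :=
  deriv (fun z => deriv (deriv u) z / deriv u z) τ - 1 / 2 * (deriv (deriv u) τ / deriv u τ) ^ 2

/-- The points of the upper half-plane that are `SL₂(ℤ)`-equivalent to `ρ = exp(2πi/3)` or to
one of the `wᵢ`. -/
def poleSet {n : ℕ} (w : Fin n → ℍ) : Set ℍ :=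
  {τ | τ ∈ MulAction.orbit SL(2, ℤ) UpperHalfPlane.ρ ∨
    ∃ i, τ ∈ MulAction.orbit SL(2, ℤ) (w i)}

end ModularSchwarz

end

noncomputable section

namespace ModularSchwarz

open Filter UpperHalfPlane
open EisensteinSeries (E2)
open ModularForm (eta E₄ E₆)
open scoped Manifold ModularForm

/-! ### Level-one modular forms -/

/-! Write `f = 1 / y²` with `y = E₄ ∏ᵢ (J - xᵢ) / η¹⁰`, of weight `-1`. If `h' = 1 / y²`, then the
Schwarz derivative of `h` is `-2 y'' / y`, so everything rests on the linear equation `y'' = -π²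
((12n+5)/6)² E₄ y` (`deriv_deriv_y`). The constant is the one forced by the leading term
`q^(-(12n+5)/12)` of `y` at the cusp.

The equation comes from a Riccati equation for the logarithmic derivative of `y`
(`hasDerivAt_logDerivY`). Ramanujan's formulas for the derivatives of `E₂`, `E₄`, `E₆` reduce it to
an identity in `t = J` which is the hypergeometric equation of `P = ∏ (t - xᵢ)`. The algebraic
system says exactly that `P` satisfies it (`sum_inv_sub_identity`).

The zeros of `y` are simple, and there the equation gives `y'' = 0`. This makes the residue of `1 /
y²` vanish (`exists_principal_part`), so `f` has meromorphic primitives on discs. Since compact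
subsets of the half-plane lie in discs, the integral does not depend on the path.

That the poles are exactly the orbits of `ρ` and the `wᵢ` requires `J` to separate orbits
(`mem_orbit_of_J_eq`). This is a connectedness argument in `ℂ ∖ {0, 1}`. -/

/-- A holomorphic function on the upper half-plane that is invariant under the weight `k` action
of `SL₂(ℤ)` and bounded at the cusp is a modular form of level one. -/
def levelOneForm (k : ℤ) (F : ℍ → ℂ) (holo : MDiff F)
    (slash : ∀ γ : SL(2, ℤ), (F ∣[k] γ) = F) (bdd : IsBoundedAtImInfty F) :
    ModularForm 𝒮ℒ k where
  toFun := F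
  slash_action_eq' := fun _ ⟨γ, hγ⟩ ↦ hγ ▸ slash γ
  holo' := holo
  bdd_at_cusps' {c} hc := by
    rw [Subgroup.IsArithmetic.isCusp_iff_isCusp_SL2Z] at hc
    rw [OnePoint.isBoundedAt_iff_forall_SL2Z hc]
    intro γ _
    rwa [slash γ]

/-- In a one-dimensional space a form is determined by its value at the cusp. Each of Ramanujan's
identities thereby becomes the computation of a limit. -/
lemma eq_const_mul_of_rank_one {k : ℤ} (hk : Module.rank ℂ (ModularForm 𝒮ℒ k) = 1)
    (G : ModularForm 𝒮ℒ k) (hG : Tendsto G atImInfty (𝓝 1)) (F : ℍ → ℂ) (holo : MDiff F)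
    (slash : ∀ γ : SL(2, ℤ), (F ∣[k] γ) = F) {v : ℂ} (lim : Tendsto F atImInfty (𝓝 v)) (z : ℍ) :
    F z = v * G z := by
  have hG0 : G ≠ 0 := by
    rintro rfl
    exact one_ne_zero (tendsto_nhds_unique hG tendsto_const_nhds)
  obtain ⟨c, hc⟩ := (finrank_eq_one_iff_of_nonzero' G hG0).mp
    (Module.rank_eq_one_iff_finrank_eq_one.mp hk)
    (levelOneForm k F holo slash (lim.isBigO_one ℝ))
  have hF : ∀ z, F z = c * G z := fun z ↦ (DFunLike.congr_fun hc z).symm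
  have hcv : c = v := by
    refine tendsto_nhds_unique ?_ lim
    simpa [show F = fun z ↦ c * G z from funext hF] using hG.const_mul c
  rw [hF, hcv]

lemma tendsto_E_atImInfty {k : ℕ} (hk : 3 ≤ k) (hk2 : Even k) :
    Tendsto (ModularForm.E hk : ℍ → ℂ) atImInfty (𝓝 1) := by
  have h1 := ModularFormClass.analyticAt_cuspFunction_zero (ModularForm.E hk) one_pos
    one_mem_strictPeriods_SL
  have h0 : cuspFunction 1 (ModularForm.E hk) 0 = 1 := by
    simpa [qExpansion_coeff] using EisensteinSeries.E_qExpansion_coeff_zero hk hk2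
  have := (h0 ▸ h1.continuousAt.tendsto).comp (qParam_tendsto_atImInfty one_pos)
  refine this.congr fun τ ↦ ?_
  exact SlashInvariantFormClass.eq_cuspFunction _ τ one_mem_strictPeriods_SL one_ne_zero

/-! ### Functions of `q` -/

lemma tendsto_of_eq_comp_qParam {g : ℍ → ℂ} {F : ℂ → ℂ} (hF : ContinuousAt F 0)
    (h : ∀ τ : ℍ, g τ = F (Function.Periodic.qParam 1 τ)) :
    Tendsto g atImInfty (𝓝 (F 0)) :=
  (hF.tendsto.comp (qParam_tendsto_atImInfty one_pos)).congr fun τ ↦ (h τ).symm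

lemma hasDerivAt_qParam (h : ℝ) (z : ℂ) : HasDerivAt (Function.Periodic.qParam h)
    (Function.Periodic.qParam h z * (2 * Real.pi * Complex.I / h)) z := by
  have h1 : HasDerivAt (fun z : ℂ ↦ 2 * Real.pi * Complex.I * z / h)
      (2 * Real.pi * Complex.I / h) z := by
    simpa using ((hasDerivAt_id z).const_mul (2 * Real.pi * Complex.I)).div_const (h : ℂ)
  exact h1.cexp

/-- By the chain rule the derivative carries a factor `q`, which tends to `0`. -/
lemma tendsto_deriv_of_eq_comp_qParam {g F : ℂ → ℂ} (hF : AnalyticAt ℂ F 0)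
    (h : ∀ τ : ℍ, g τ = F (Function.Periodic.qParam 1 τ)) :
    Tendsto (fun τ : ℍ ↦ deriv g τ) atImInfty (𝓝 0) := by
  have hev : ∀ᶠ τ : ℍ in atImInfty, AnalyticAt ℂ F (Function.Periodic.qParam 1 τ) :=
    (qParam_tendsto_atImInfty one_pos).eventually hF.eventually_analyticAt
  have hlim := ((hF.deriv.continuousAt.tendsto.comp
    (qParam_tendsto_atImInfty one_pos)).mul (qParam_tendsto_atImInfty one_pos)).mul_const
      (2 * Real.pi * Complex.I)
  rw [mul_zero, zero_mul] at hlim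
  refine hlim.congr' ?_
  filter_upwards [hev] with τ hτ
  have h1 := hτ.differentiableAt.hasDerivAt.comp (τ : ℂ) (hasDerivAt_qParam 1 τ)
  have h2 : g =ᶠ[𝓝 (τ : ℂ)] F ∘ Function.Periodic.qParam 1 := by
    filter_upwards [isOpen_upperHalfPlaneSet.mem_nhds τ.2] with z hz
    exact h ⟨z, hz⟩
  rw [h2.deriv_eq, h1.deriv]
  simp
  ring

/-- Euler's product `∏ (1 - qⁿ)`. -/
def eulerProd (q : ℂ) : ℂ := ∏' n : ℕ, (1 - q ^ (n + 1))

lemma analyticAt_eulerProd {q : ℂ} (hq : ‖q‖ < 1) : AnalyticAt ℂ eulerProd q :=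
  ModularForm.differentiableOn_tprod_one_sub_pow.analyticAt
    (Metric.isOpen_ball.mem_nhds (by simpa using hq))

@[simp] lemma eulerProd_zero : eulerProd 0 = 1 := by simp [eulerProd]

lemma eta_eq (z : ℂ) :
    eta z = Function.Periodic.qParam 24 z * eulerProd (Function.Periodic.qParam 1 z) := rfl

lemma differentiableAt_eta (τ : ℍ) : DifferentiableAt ℂ eta τ :=
  ModularForm.differentiableAt_eta_of_mem_upperHalfPlaneSet τ.2

lemma eta_ne_zero (τ : ℍ) : eta τ ≠ 0 := ModularForm.eta_ne_zero τ.2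

lemma norm_qParam_lt_one (τ : ℍ) : ‖Function.Periodic.qParam 1 (τ : ℂ)‖ < 1 :=
  Function.Periodic.norm_qParam_lt_one one_pos τ.im_pos

/-- `E₂` as a function of `q`. -/
def E2q (q : ℂ) : ℂ := 1 + 24 * q * deriv eulerProd q / eulerProd q

lemma analyticAt_E2q : AnalyticAt ℂ E2q 0 := by
  have h := analyticAt_eulerProd (q := 0) (by simp)
  unfold E2q
  exact analyticAt_const.add (((analyticAt_const.mul analyticAt_id).mul h.deriv).div h (by simp))

/-- `E₂` is not modular, so its expansion in `q` is read off from the logarithmic derivative of the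
product for `η`. -/
lemma E2_eq_E2q (τ : ℍ) : E2 τ = E2q (Function.Periodic.qParam 1 τ) := by
  have h1 := ModularForm.logDeriv_eta_eq_E2 τ
  have h2 := (analyticAt_eulerProd (norm_qParam_lt_one τ)).differentiableAt.hasDerivAt.comp
    (τ : ℂ) (hasDerivAt_qParam 1 τ)
  have h3 := (hasDerivAt_qParam 24 τ).mul h2
  have h4 : deriv eta τ = _ := h3.deriv
  have hne := eta_ne_zero τ
  rw [eta_eq] at hne
  have hP := right_ne_zero_of_mul hne
  have hQ := left_ne_zero_of_mul hne
  rw [logDeriv_apply, h4, eta_eq] at h1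
  have hpi : (Real.pi : ℂ) * Complex.I ≠ 0 := by simp
  rw [E2q]
  apply mul_left_cancel₀ hpi
  simp only [Function.comp_apply] at h1
  field_simp at h1 ⊢
  push_cast at h1
  linear_combination (-1 / 24 : ℂ) * h1

/-! ### Ramanujan's differential equations -/

open Derivative in
lemma tendsto_normalizedDeriv {g : ℍ → ℂ} {F : ℂ → ℂ} (hF : AnalyticAt ℂ F 0)
    (h : ∀ τ : ℍ, g τ = F (Function.Periodic.qParam 1 τ)) :
    Tendsto (normalizedDerivOfComplex g) atImInfty (𝓝 0) := by
  have := (tendsto_deriv_of_eq_comp_qParam (g := g ∘ ofComplex) hF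
    (fun τ ↦ by simp [h])).const_mul ((2 * Real.pi * Complex.I)⁻¹)
  rw [mul_zero] at this
  exact this

lemma tendsto_E2 : Tendsto E2 atImInfty (𝓝 1) := by
  simpa [E2q] using tendsto_of_eq_comp_qParam analyticAt_E2q.continuousAt E2_eq_E2q

lemma tendsto_E₄ : Tendsto E₄ atImInfty (𝓝 1) := tendsto_E_atImInfty _ ⟨2, rfl⟩

lemma tendsto_E₆ : Tendsto E₆ atImInfty (𝓝 1) := tendsto_E_atImInfty _ ⟨3, rfl⟩

lemma slash_modularForm {k : ℤ} (F : ModularForm 𝒮ℒ k) (γ : SL(2, ℤ)) :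
    ((F : ℍ → ℂ) ∣[k] γ) = F := F.slash_action_eq' _ ⟨γ, rfl⟩

/-- The derivative dies at the cusp, and only `-(k/12) E₂ F` survives. -/
lemma tendsto_serreDerivative {k : ℤ} (F : ModularForm 𝒮ℒ k)
    (hF : Tendsto F atImInfty (𝓝 1)) :
    Tendsto (Derivative.serreDerivative k F) atImInfty (𝓝 (-(k : ℂ) / 12)) := by
  have h1 := tendsto_normalizedDeriv (g := F)
    (ModularFormClass.analyticAt_cuspFunction_zero F one_pos one_mem_strictPeriods_SL)
    (fun τ ↦ (SlashInvariantFormClass.eq_cuspFunction F τ one_mem_strictPeriods_SL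
      one_ne_zero).symm)
  have h2 := h1.sub ((tendsto_E2.const_mul ((k : ℂ) * 12⁻¹)).mul hF)
  convert! h2 using 2
  ring

lemma serreDerivative_E₄ (z : ℍ) : Derivative.serreDerivative 4 E₄ z = -1 / 3 * E₆ z := by
  have hs : ∀ γ : SL(2, ℤ), (Derivative.serreDerivative (4 : ℤ) E₄ ∣[(6 : ℤ)] γ) =
      Derivative.serreDerivative (4 : ℤ) E₄ := fun γ ↦
    Derivative.serreDerivative_slash_invariant (k := 4) E₄.holo' (slash_modularForm E₄ γ)
  have := eq_const_mul_of_rank_one ModularForm.levelOne_weight_six_rank_one E₆ tendsto_E₆ _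
    (Derivative.serreDerivative_mdifferentiable _ E₄.holo') hs
    (tendsto_serreDerivative E₄ tendsto_E₄) z
  norm_num at this ⊢
  linear_combination this

lemma rank_weight_eight : Module.rank ℂ (ModularForm 𝒮ℒ 8) = 1 := by
  have := ModularForm.dimension_level_one 8 ⟨4, rfl⟩
  simpa [Nat.ModEq] using this

/-- The Serre derivative has weight eight, where `E₄²` spans; the constant is `-6/12`. -/
lemma serreDerivative_E₆ (z : ℍ) : Derivative.serreDerivative 6 E₆ z = -1 / 2 * E₄ z ^ 2 := by
  have hs : ∀ γ : SL(2, ℤ), (Derivative.serreDerivative (6 : ℤ) E₆ ∣[(8 : ℤ)] γ) =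
      Derivative.serreDerivative (6 : ℤ) E₆ := fun γ ↦
    Derivative.serreDerivative_slash_invariant (k := 6) E₆.holo' (slash_modularForm E₆ γ)
  have h1 : Tendsto (E₄.mul E₄ : ℍ → ℂ) atImInfty (𝓝 1) := by
    simpa using! tendsto_E₄.mul tendsto_E₄
  have := eq_const_mul_of_rank_one rank_weight_eight (E₄.mul E₄) h1 _
    (Derivative.serreDerivative_mdifferentiable _ E₆.holo') hs
    (tendsto_serreDerivative E₆ tendsto_E₆) z
  have h2 : (E₄.mul E₄ : ℍ → ℂ) z = E₄ z * E₄ z := rfl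
  rw [h2] at this
  norm_num at this ⊢
  linear_combination this

/-- The modular form `D E₂ - E₂² / 12` of weight four. -/
def ramanujanE2 (z : ℍ) : ℂ := Derivative.normalizedDerivOfComplex E2 z - E2 z ^ 2 / 12

lemma mdifferentiable_ramanujanE2 : MDiff ramanujanE2 := by
  have h1 := Derivative.normalizedDerivOfComplex_mdifferentiable E2_mdifferentiable
  have h2 : MDiff (fun z ↦ (12⁻¹ : ℂ) * (E2 z * E2 z)) :=
    mdifferentiable_const.mul (E2_mdifferentiable.mul E2_mdifferentiable)
  have h3 : ramanujanE2 = Derivative.normalizedDerivOfComplex E2 -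
      fun z ↦ (12⁻¹ : ℂ) * (E2 z * E2 z) := by
    ext z
    simp only [ramanujanE2, Pi.sub_apply]
    ring
  rw [h3]
  exact h1.sub h2

/-- The anomaly of `E₂`, a multiple of `c / (cz + d)`, enters both the derivative and the square,
and the coefficient `1/12` makes the contributions cancel. -/
lemma ramanujanE2_slash (γ : SL(2, ℤ)) : (ramanujanE2 ∣[(4 : ℤ)] γ) = ramanujanE2 := by
  ext z
  have hd := denom_ne_zero γ z
  have h0 : ∀ w : ℍ, (E2 ∣[(2 : ℤ)] γ) w = E2 w - 1 / (2 * riemannZeta 2) *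
      ((2 * Real.pi * Complex.I * γ 1 0) / denom γ w) := fun w ↦ by
    rw [EisensteinSeries.E2_slash_action]; rfl
  have h1 : Derivative.normalizedDerivOfComplex (E2 ∣[(2 : ℤ)] γ) z =
      Derivative.normalizedDerivOfComplex E2 z + 1 / (2 * riemannZeta 2) *
        ((γ 1 0 : ℂ) ^ 2 / denom γ z ^ 2) := by
    have hE : HasDerivAt (E2 ∘ ofComplex) (deriv (E2 ∘ ofComplex) z) (z : ℂ) :=
      (mdifferentiableAt_iff.mp (E2_mdifferentiable z)).hasDerivAt
    have hD : HasDerivAt (fun w : ℂ ↦ (γ 1 0 : ℂ) * w + γ 1 1) (γ 1 0 : ℂ) (z : ℂ) := by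
      simpa using ((hasDerivAt_id (z : ℂ)).const_mul (γ 1 0 : ℂ)).add_const (γ 1 1 : ℂ)
    have hdz : denom γ z = (γ 1 0 : ℂ) * z + γ 1 1 := ModularGroup.denom_apply γ z
    rw [hdz] at hd
    have h2 := hE.sub (((hD.inv hd).const_mul (2 * Real.pi * Complex.I * γ 1 0)).const_mul
      (1 / (2 * riemannZeta 2)))
    have h3 : ((E2 ∣[(2 : ℤ)] γ) ∘ ofComplex) =ᶠ[𝓝 (z : ℂ)] fun w : ℂ ↦ (E2 ∘ ofComplex) w -
        1 / (2 * riemannZeta 2) * (2 * Real.pi * Complex.I * γ 1 0 *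
          ((γ 1 0 : ℂ) * w + γ 1 1)⁻¹) := by
      filter_upwards [isOpen_upperHalfPlaneSet.mem_nhds z.2] with w hw
      have hw' : ofComplex w = ⟨w, hw⟩ := ofComplex_apply_of_im_pos hw
      rw [Function.comp_apply, Function.comp_apply, h0, hw', ModularGroup.denom_apply,
        div_eq_mul_inv (2 * Real.pi * Complex.I * γ 1 0 : ℂ)]
    rw [Derivative.normalizedDerivOfComplex, Derivative.normalizedDerivOfComplex,
      h3.deriv_eq, hdz]
    refine (congrArg _ h2.deriv).trans ?_
    have : (Real.pi : ℂ) * Complex.I ≠ 0 := by simp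
    field_simp
    ring
  have h2 := congrFun (Derivative.normalizedDerivOfComplex_SL_slash (k := 2) (γ := γ)
    E2_mdifferentiable) z
  have h3 := h0 z
  simp only [ModularForm.SL_slash_apply, Pi.sub_apply] at h2 h3 ⊢
  rw [h1, h3] at h2
  have hz : (riemannZeta 2)⁻¹ = 6 * (Real.pi : ℂ)⁻¹ ^ 2 := by
    rw [riemannZeta_two, inv_div, inv_pow]; rfl
  have hpi : (Real.pi : ℂ) * (Real.pi : ℂ)⁻¹ = 1 := mul_inv_cancel₀ (by simp)
  have h4 : denom γ z ^ (-4 : ℤ) = ((denom γ z)⁻¹) ^ 4 := by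
    rw [zpow_neg, ← inv_zpow]; norm_cast
  have h6 : denom γ z ^ (-2 : ℤ) = ((denom γ z)⁻¹) ^ 2 := by
    rw [zpow_neg, ← inv_zpow]; norm_cast
  have h5 : denom γ z ^ (-(2 + 2) : ℤ) = ((denom γ z)⁻¹) ^ 4 := h4
  rw [h6] at h3
  rw [h5] at h2
  rw [h4]
  simp only [ramanujanE2, div_eq_mul_inv, mul_inv, hz, Complex.inv_I, ← inv_pow] at h2 h3 ⊢
  -- What remains is a polynomial identity in these quantities, modulo `π π⁻¹ = 1` and `i² = -1`.
  generalize Derivative.normalizedDerivOfComplex E2 (γ • z) = A at *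
  generalize Derivative.normalizedDerivOfComplex E2 z = B at *
  generalize E2 (γ • z) = a at *
  generalize E2 z = b at *
  generalize (denom γ z)⁻¹ = u at *
  generalize (Real.pi : ℂ)⁻¹ = p at *
  generalize (Real.pi : ℂ) = q at *
  generalize (γ 1 0 : ℂ) = c at *
  have hI2 := Complex.I_sq
  generalize Complex.I = i at *
  push_cast at h2
  have h3' : a * u ^ 2 = b - 6 * i * p * c * u := by
    linear_combination h3 - 6 * p * i * c * u * hpi
  have h2' : A * u ^ 4 = B + 3 * p ^ 2 * c ^ 2 * u ^ 2 - i * p * c * u * (b - 6 * i * p * c * u) := by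
    linear_combination -h2 + 6 * p ^ 2 * i ^ 2 * c ^ 2 * u ^ 2 * hpi
  linear_combination h2' - (a * u ^ 2 + b - 6 * i * p * c * u) / 12 * h3' +
    3 * p ^ 2 * c ^ 2 * u ^ 2 * hI2

lemma ramanujanE2_eq (z : ℍ) : ramanujanE2 z = -1 / 12 * E₄ z := by
  refine eq_const_mul_of_rank_one ModularForm.levelOne_weight_four_rank_one E₄ tendsto_E₄ _
    mdifferentiable_ramanujanE2 ramanujanE2_slash ?_ z
  have h1 := (tendsto_normalizedDeriv analyticAt_E2q E2_eq_E2q).sub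
    ((tendsto_E2.pow 2).div_const 12)
  convert! h1 using 2
  norm_num

/-- `E₂` as a function of a complex variable. -/
def E2c (z : ℂ) : ℂ := E2 (ofComplex z)

/-- `E₆` as a function of a complex variable. -/
def E6 (z : ℂ) : ℂ := E₆ (ofComplex z)

@[simp] lemma E4_coe (τ : ℍ) : E4 τ = E₄ τ := by simp [E4]

@[simp] lemma E6_coe (τ : ℍ) : E6 τ = E₆ τ := by simp [E6]

@[simp] lemma E2c_coe (τ : ℍ) : E2c τ = E2 τ := by simp [E2c]

/-! ### Derivatives of `E₂`, `E₄`, `E₆` and `η` along `ℂ` -/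

lemma hasDerivAt_of_normalizedDeriv {F : ℍ → ℂ} (hF : MDiff F) (τ : ℍ) :
    HasDerivAt (fun z : ℂ ↦ F (ofComplex z))
      (2 * Real.pi * Complex.I * Derivative.normalizedDerivOfComplex F τ) τ := by
  have h1 : HasDerivAt (F ∘ ofComplex) (deriv (F ∘ ofComplex) τ) (τ : ℂ) :=
    (mdifferentiableAt_iff.mp (hF τ)).hasDerivAt
  convert! h1 using 1
  rw [Derivative.normalizedDerivOfComplex, mul_inv_cancel_left₀ (by simp)]

lemma hasDerivAt_E4 (τ : ℍ) : HasDerivAt E4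
    (2 * Real.pi * Complex.I * ((E2c τ * E4 τ - E6 τ) / 3)) τ := by
  convert! hasDerivAt_of_normalizedDeriv (F := E₄) E₄.holo' τ using 2
  have := serreDerivative_E₄ τ
  simp only [Derivative.serreDerivative_apply] at this
  simp only [E4_coe, E6_coe, E2c_coe]
  linear_combination -this

lemma hasDerivAt_E6 (τ : ℍ) : HasDerivAt E6
    (2 * Real.pi * Complex.I * ((E2c τ * E6 τ - E4 τ ^ 2) / 2)) τ := by
  convert! hasDerivAt_of_normalizedDeriv (F := E₆) E₆.holo' τ using 2
  have := serreDerivative_E₆ τ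
  simp only [Derivative.serreDerivative_apply] at this
  simp only [E4_coe, E6_coe, E2c_coe]
  linear_combination -this

lemma hasDerivAt_E2c (τ : ℍ) : HasDerivAt E2c
    (2 * Real.pi * Complex.I * ((E2c τ ^ 2 - E4 τ) / 12)) τ := by
  convert! hasDerivAt_of_normalizedDeriv (F := E2) E2_mdifferentiable τ using 2
  have := ramanujanE2_eq τ
  simp only [ramanujanE2] at this
  simp only [E4_coe, E2c_coe]
  linear_combination -this

lemma hasDerivAt_eta (τ : ℍ) : HasDerivAt eta
    (2 * Real.pi * Complex.I * (E2c τ * eta τ / 24)) τ := by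
  convert! (differentiableAt_eta τ).hasDerivAt using 1
  have h1 := ModularForm.logDeriv_eta_eq_E2 τ
  rw [logDeriv_apply, div_eq_iff (eta_ne_zero τ)] at h1
  rw [h1, E2c_coe]
  ring

lemma E4_cube_sub_E6_sq (τ : ℍ) : E4 τ ^ 3 - E6 τ ^ 2 = 1728 * eta τ ^ 24 := by
  have := ModularForm.discriminant_eq_E₄_cube_sub_E₆_sq τ
  rw [ModularForm.discriminant] at this
  rw [this, E4_coe, E6_coe]
  ring

end ModularSchwarz
end

noncomputable section

namespace ModularSchwarz

open Filter UpperHalfPlane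
open EisensteinSeries (E2)
open ModularForm (eta E₄ E₆)
open scoped Manifold ModularForm

/-! ### The modular function `J` -/

lemma eta_pow_ne_zero (τ : ℍ) (n : ℕ) : eta τ ^ n ≠ 0 := pow_ne_zero n (eta_ne_zero τ)

lemma J_sub_one (τ : ℍ) : J τ - 1 = E6 τ ^ 2 / (1728 * eta τ ^ 24) := by
  have := eta_pow_ne_zero τ 24
  have h := E4_cube_sub_E6_sq τ
  have h2 : (1728 * eta τ ^ 24 : ℂ) ≠ 0 := mul_ne_zero (by norm_num) this
  rw [J, eq_div_iff h2, sub_mul, div_mul_cancel₀ _ h2]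
  linear_combination h

/-- The `E₂` terms cancel because numerator and denominator of `J` have the same weight. Critical
points are therefore zeros of `E₄` or `E₆`, where `J` is `0` or `1`. -/
lemma hasDerivAt_J (τ : ℍ) : HasDerivAt J
    (2 * Real.pi * Complex.I * (-(E4 τ ^ 2 * E6 τ) / (1728 * eta τ ^ 24))) τ := by
  have h1 := ((hasDerivAt_E4 τ).pow 3).div (((hasDerivAt_eta τ).pow 24).const_mul 1728)
    (mul_ne_zero (by norm_num) (eta_pow_ne_zero τ 24))
  convert! h1 using 1
  have := eta_ne_zero τ
  simp only [Pi.pow_apply]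
  field_simp
  ring

/-! ### Analyticity, invariance and special values of `J` -/

lemma analyticAt_of_forall_hasDerivAt {g : ℂ → ℂ} {g' : ℍ → ℂ}
    (h : ∀ τ : ℍ, HasDerivAt g (g' τ) τ) (τ : ℍ) : AnalyticAt ℂ g τ :=
  DifferentiableOn.analyticAt (s := upperHalfPlaneSet)
    (fun z hz ↦ (h ⟨z, hz⟩).differentiableAt.differentiableWithinAt)
    (isOpen_upperHalfPlaneSet.mem_nhds τ.2)

lemma analyticAt_E4 (τ : ℍ) : AnalyticAt ℂ E4 τ := analyticAt_of_forall_hasDerivAt hasDerivAt_E4 τ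
lemma analyticAt_eta (τ : ℍ) : AnalyticAt ℂ eta τ :=
  analyticAt_of_forall_hasDerivAt hasDerivAt_eta τ
lemma analyticAt_J (τ : ℍ) : AnalyticAt ℂ J τ := analyticAt_of_forall_hasDerivAt hasDerivAt_J τ

lemma E4_smul (γ : SL(2, ℤ)) (τ : ℍ) :
    E4 ((γ • τ : ℍ) : ℂ) = denom (γ : GL (Fin 2) ℝ) τ ^ 4 * E4 τ := by
  have h := congrFun (slash_modularForm E₄ γ) τ
  rw [ModularForm.SL_slash_apply, zpow_neg, mul_inv_eq_iff_eq_mul₀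
    (zpow_ne_zero _ (denom_ne_zero _ τ))] at h
  rw [E4_coe, E4_coe, h, mul_comm]
  norm_cast

lemma eta_pow_smul (γ : SL(2, ℤ)) (τ : ℍ) :
    eta ((γ • τ : ℍ) : ℂ) ^ 24 = denom (γ : GL (Fin 2) ℝ) τ ^ 12 * eta τ ^ 24 := by
  have h : ((CuspForm.discriminant : ℍ → ℂ) ∣[(12 : ℤ)] γ) τ = CuspForm.discriminant τ :=
    congrFun (CuspForm.discriminant.slash_action_eq' _ ⟨γ, rfl⟩) τ
  rw [ModularForm.SL_slash_apply, zpow_neg, mul_inv_eq_iff_eq_mul₀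
    (zpow_ne_zero _ (denom_ne_zero _ τ))] at h
  rw [mul_comm]
  exact h

lemma J_smul (γ : SL(2, ℤ)) (τ : ℍ) : J ((γ • τ : ℍ) : ℂ) = J τ := by
  have h1 := denom_ne_zero (γ : GL (Fin 2) ℝ) τ
  have h2 := eta_pow_ne_zero τ 24
  rw [J, E4_smul, eta_pow_smul, J]
  field_simp

lemma J_eq_zero_iff (τ : ℍ) : J τ = 0 ↔ E4 τ = 0 := by
  simp [J, eta_ne_zero τ]

lemma J_eq_one_iff (τ : ℍ) : J τ = 1 ↔ E6 τ = 0 := by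
  rw [← sub_eq_zero, J_sub_one]
  simp [eta_ne_zero τ]

lemma deriv_J_ne_zero {τ : ℍ} (h0 : J τ ≠ 0) (h1 : J τ ≠ 1) : deriv J τ ≠ 0 := by
  rw [(hasDerivAt_J τ).deriv]
  rw [Ne, J_eq_zero_iff] at h0
  rw [Ne, J_eq_one_iff] at h1
  simp [eta_ne_zero τ, h0, h1, -E4_coe, -E6_coe]

/-- `1 / J` as a function of `q`. -/
def Jinvq (q : ℂ) : ℂ := 1728 * q * eulerProd q ^ 24 / cuspFunction 1 E₄ q ^ 3

lemma analyticAt_cuspFunction_E₄ : AnalyticAt ℂ (cuspFunction 1 E₄) 0 :=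
  ModularFormClass.analyticAt_cuspFunction_zero E₄ one_pos one_mem_strictPeriods_SL

lemma cuspFunction_E₄_zero : cuspFunction 1 E₄ 0 = 1 := by
  simpa [qExpansion_coeff] using EisensteinSeries.E_qExpansion_coeff_zero (k := 4) _ ⟨2, rfl⟩

lemma cuspFunction_E₄_qParam (τ : ℍ) : cuspFunction 1 E₄ (Function.Periodic.qParam 1 τ) = E4 τ := by
  rw [E4_coe]
  exact SlashInvariantFormClass.eq_cuspFunction _ τ one_mem_strictPeriods_SL one_ne_zero

lemma eta_pow_eq (τ : ℍ) : eta τ ^ 24 = Function.Periodic.qParam 1 τ *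
    eulerProd (Function.Periodic.qParam 1 τ) ^ 24 := by
  rw [eta_eq, mul_pow, Function.Periodic.qParam, ← Complex.exp_nat_mul, Function.Periodic.qParam]
  congr 2
  push_cast
  ring

lemma J_eq_inv (τ : ℍ) : J τ = (Jinvq (Function.Periodic.qParam 1 τ))⁻¹ := by
  rw [J, Jinvq, inv_div, cuspFunction_E₄_qParam, eta_pow_eq, mul_assoc]

/-- The nonzero derivative makes `1 / J` a local coordinate at the cusp, equivalent to `q`. -/
lemma hasStrictDerivAt_Jinvq : HasStrictDerivAt Jinvq 1728 0 := by
  have h1 := (analyticAt_eulerProd (q := 0) (by simp)).hasStrictDerivAt.pow 24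
  have h2 := analyticAt_cuspFunction_E₄.hasStrictDerivAt.pow 3
  have h3 := (((hasStrictDerivAt_id (0 : ℂ)).const_mul 1728).mul h1).div h2
    (by simp [cuspFunction_E₄_zero])
  convert! h3 using 1
  simp [cuspFunction_E₄_zero]

lemma tendsto_J_atImInfty : Tendsto (fun τ : ℍ ↦ J τ) atImInfty (Bornology.cobounded ℂ) := by
  have h1 : Tendsto (fun τ : ℍ ↦ Jinvq (Function.Periodic.qParam 1 τ)) atImInfty (𝓝[≠] 0) := by
    refine tendsto_nhdsWithin_iff.mpr ⟨?_, ?_⟩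
    · have : Jinvq 0 = 0 := by simp [Jinvq]
      have h2 := hasStrictDerivAt_Jinvq.hasDerivAt.continuousAt.tendsto
      rw [this] at h2
      exact h2.comp (qParam_tendsto_atImInfty one_pos)
    · have h2 := tendsto_E₄.eventually_ne (one_ne_zero)
      filter_upwards [h2] with τ hτ
      have h3 : J τ ≠ 0 := by rwa [Ne, J_eq_zero_iff, E4_coe]
      rw [J_eq_inv] at h3
      exact fun h4 ↦ h3 (by rw [h4, inv_zero])
  exact (tendsto_inv₀_nhdsNE_zero.comp h1).congr fun τ ↦ (J_eq_inv τ).symm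

/-- `ST` fixes `ρ` with automorphy factor `ρ + 1`, and `(ρ + 1)⁴ = ρ² ≠ 1`. -/
lemma E4_rho : E4 UpperHalfPlane.ρ = 0 := by
  have h1 : (ModularGroup.S * ModularGroup.T) • UpperHalfPlane.ρ = UpperHalfPlane.ρ := by
    rw [ModularGroup.stabilizer_ρ]; simp
  have h2 := E4_smul (ModularGroup.S * ModularGroup.T) UpperHalfPlane.ρ
  rw [h1, ModularGroup.denom_apply,
    show (ModularGroup.S * ModularGroup.T : SL(2, ℤ)) 1 0 = 1 from rfl,
    show (ModularGroup.S * ModularGroup.T : SL(2, ℤ)) 1 1 = 1 from rfl] at h2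
  have h3 := UpperHalfPlane.ρ_sq
  have h4 : (UpperHalfPlane.ρ + 2 : ℂ) * E4 UpperHalfPlane.ρ = 0 := by
    push_cast at h2
    linear_combination h2 + E4 UpperHalfPlane.ρ *
      ((UpperHalfPlane.ρ : ℂ) ^ 2 + 3 * UpperHalfPlane.ρ + 2) * h3
  refine (mul_eq_zero.mp h4).resolve_left fun h ↦ ?_
  have h5 := congrArg Complex.im h
  simp [UpperHalfPlane.ρ] at h5

/-! ### Injectivity of `J` on orbits -/

/-- This is the Hausdorff property of the orbit space. -/
lemma isClosed_orbitRel : IsClosed {p : ℍ × ℍ | p.1 ∈ MulAction.orbit SL(2, ℤ) p.2} := by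
  have h1 : IsClosed {p : ℍ × ℍ | (Quotient.mk _ p.1 : MulAction.orbitRel.Quotient 𝒮ℒ ℍ) =
      Quotient.mk _ p.2} :=
    isClosed_eq (continuous_quotient_mk'.comp continuous_fst)
      (continuous_quotient_mk'.comp continuous_snd)
  convert! h1 using 1
  ext p
  rw [Set.mem_ofPred_eq, Set.mem_ofPred_eq, Quotient.eq, MulAction.orbitRel_apply]
  constructor
  · rintro ⟨γ, hγ⟩
    exact ⟨⟨γ, γ, rfl⟩, hγ⟩
  · rintro ⟨⟨_, γ, rfl⟩, hγ⟩
    exact ⟨γ, hγ⟩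

lemma J_eq_of_mem_orbit {z w : ℍ} (h : z ∈ MulAction.orbit SL(2, ℤ) w) : J z = J w := by
  obtain ⟨γ, rfl⟩ := h
  exact J_smul γ w

lemma continuous_J : Continuous fun τ : ℍ ↦ J τ :=
  continuous_iff_continuousAt.mpr fun τ ↦
    (hasDerivAt_J τ).continuousAt.comp continuous_coe.continuousAt

/-- Open mapping theorem: `J` is not constant, since it tends to infinity at the cusp. -/
lemma nhds_le_map_J (τ : ℍ) : 𝓝 (J τ) ≤ map (fun z : ℍ ↦ J z) (𝓝 τ) := by
  have h0 : map (fun z : ℍ ↦ J z) (𝓝 τ) = map J (𝓝 (τ : ℂ)) := by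
    rw [← isOpenEmbedding_coe.map_nhds_eq, map_map, Function.comp_def]
  rw [h0]
  refine (analyticAt_J τ).eventually_constant_or_nhds_le_map_nhds.resolve_left fun hc ↦ ?_
  have h1 : Set.EqOn J (fun _ ↦ J τ) upperHalfPlaneSet := by
    refine AnalyticOnNhd.eqOn_of_preconnected_of_eventuallyEq
      (fun z hz ↦ analyticAt_J ⟨z, hz⟩) (fun z _ ↦ analyticAt_const)
      (convex_halfSpace_im_gt 0).isPreconnected τ.2 hc
  have h2 : ∀ᶠ z : ℍ in atImInfty, J z ≠ J τ :=
    tendsto_J_atImInfty.eventually (p := fun x ↦ x ≠ J τ)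
      (Bornology.eventually_ne_cobounded (J τ))
  obtain ⟨z, hz⟩ := h2.exists
  exact hz (h1 (x := (z : ℂ)) z.2)

lemma exists_injOn_J {τ : ℍ} (h0 : J τ ≠ 0) (h1 : J τ ≠ 1) :
    ∃ N ∈ 𝓝 τ, ∀ z ∈ N, ∀ w ∈ N, J z = J w → z = w := by
  have hs := ((analyticAt_J τ).hasStrictDerivAt.hasStrictFDerivAt_equiv
    (deriv_J_ne_zero h0 h1)).eventually_left_inverse
  refine ⟨_, continuous_coe.continuousAt.preimage_mem_nhds hs, fun z hz w hw h ↦ ?_⟩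
  apply UpperHalfPlane.ext
  rw [← show _ = (z : ℂ) from hz, ← show _ = (w : ℂ) from hw, h]

lemma exists_im_le_of_norm_J_le (R : ℝ) : ∃ Y, ∀ τ : ℍ, ‖J τ‖ ≤ R → τ.im ≤ Y := by
  have h := tendsto_norm_cobounded_atTop.comp tendsto_J_atImInfty
  obtain ⟨Y, hY⟩ := (atImInfty_mem _).mp (h.eventually (eventually_gt_atTop R))
  refine ⟨Y, fun τ hτ ↦ ?_⟩
  by_contra hlt
  exact absurd (hY τ (not_le.mp hlt).le) (not_lt.mpr hτ)

/-- Above the maximum of `‖J‖` on a truncated fundamental domain, points can be moved close to the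
cusp. There `1 / J` is injective in `q`, and equal `q` means a translation by an integer. -/
lemma exists_orbit_eq_of_large : ∃ R : ℝ, ∀ z w : ℍ, R < ‖J z‖ → J z = J w →
    z ∈ MulAction.orbit SL(2, ℤ) w := by
  have hs := (hasStrictDerivAt_Jinvq.hasStrictFDerivAt_equiv (by norm_num)).eventually_left_inverse
  obtain ⟨Y, hY⟩ := (atImInfty_mem _).mp ((qParam_tendsto_atImInfty one_pos).eventually hs)
  obtain ⟨R, hR⟩ := ((ModularGroup.isCompact_truncatedFundamentalDomain Y).image
    continuous_J).isBounded.exists_norm_le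
  refine ⟨R, fun z w hz hzw ↦ ?_⟩
  have key : ∀ u : ℍ, R < ‖J u‖ → ∃ γ : SL(2, ℤ), Y ≤ (γ • u).im := fun u hu ↦ by
    obtain ⟨γ, hγ⟩ := ModularGroup.exists_smul_mem_fd u
    refine ⟨γ, ?_⟩
    by_contra hlt
    have := hR _ ⟨γ • u, ⟨hγ, (not_le.mp hlt).le⟩, rfl⟩
    simp only [J_smul] at this
    exact absurd hu (not_lt.mpr this)
  obtain ⟨γ, hγ⟩ := key z hz
  obtain ⟨δ, hδ⟩ := key w (hzw ▸ hz)
  have h1 : Jinvq (Function.Periodic.qParam 1 (γ • z : ℍ)) =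
      Jinvq (Function.Periodic.qParam 1 (δ • w : ℍ)) := by
    apply inv_injective
    rw [← J_eq_inv, ← J_eq_inv, J_smul, J_smul, hzw]
  have h2 : Function.Periodic.qParam 1 (γ • z : ℍ) = Function.Periodic.qParam 1 (δ • w : ℍ) := by
    rw [← show _ = Function.Periodic.qParam 1 (γ • z : ℍ) from hY _ hγ,
      ← show _ = Function.Periodic.qParam 1 (δ • w : ℍ) from hY _ hδ, h1]
  obtain ⟨m, hm⟩ := Function.Periodic.qParam_left_inv_mod_period one_ne_zero (γ • z : ℍ)
  obtain ⟨k, hk⟩ := Function.Periodic.qParam_left_inv_mod_period one_ne_zero (δ • w : ℍ)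
  rw [h2, hk] at hm
  have h3 : γ • z = ModularGroup.T ^ (k - m) • δ • w := by
    apply UpperHalfPlane.ext
    rw [ModularGroup.coe_T_zpow_smul_eq]
    push_cast at hm ⊢
    linear_combination -hm
  refine ⟨γ⁻¹ * ModularGroup.T ^ (k - m) * δ, ?_⟩
  simp only [mul_smul, ← h3, inv_smul_smul]

/-- Pairs of inequivalent points with the same value of `J`. -/
def collisions : Set (ℍ × ℍ) :=
  {p | J p.1 = J p.2 ∧ p.1 ∉ MulAction.orbit SL(2, ℤ) p.2}

/-- Inequivalence is an open condition and `J` is an open map, so nearby values are also shared by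
inequivalent points. -/
lemma mem_nhds_collision {p : ℍ × ℍ} (hp : p ∈ collisions) :
    (fun p : ℍ × ℍ ↦ J p.1) '' collisions ∈ 𝓝 (J p.1) := by
  obtain ⟨z, w⟩ := p
  obtain ⟨h1, h2⟩ := hp
  have h3 := isClosed_orbitRel.isOpen_compl.mem_nhds (x := (z, w)) h2
  obtain ⟨A, hA, B, hB, hAB⟩ := mem_nhds_prod_iff.mp h3
  have hA' := nhds_le_map_J z (image_mem_map hA)
  have hB' := nhds_le_map_J w (image_mem_map hB)
  dsimp only at h1 ⊢
  rw [← h1] at hB'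
  filter_upwards [hA', hB']
  rintro _ ⟨a, ha, rfl⟩ ⟨b, hb, hab⟩
  exact ⟨(a, b), ⟨hab.symm, hAB ⟨ha, hb⟩⟩, rfl⟩

/-- If collisions converged to a pair `(γw, w)`, moving the second point by `γ` would give distinct
points near `γw` with equal `J`. Local injectivity away from the values `0`, `1` forbids this. -/
lemma isClosed_collisions {B : Set ℂ} (hB : IsClosed B) (h0 : (0 : ℂ) ∉ B) (h1 : (1 : ℂ) ∉ B) :
    IsClosed (collisions ∩ {p | J p.1 ∈ B}) := by
  have hc1 : Continuous fun p : ℍ × ℍ ↦ J p.1 := continuous_J.comp continuous_fst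
  have hc2 : Continuous fun p : ℍ × ℍ ↦ J p.2 := continuous_J.comp continuous_snd
  have hcl : IsClosed ({p : ℍ × ℍ | J p.1 = J p.2} ∩ {p | J p.1 ∈ B}) :=
    (isClosed_eq hc1 hc2).inter (hB.preimage hc1)
  refine isClosed_of_closure_subset fun p hp ↦ ?_
  have hp1 : J p.1 = J p.2 ∧ J p.1 ∈ B :=
    hcl.closure_subset_iff.mpr (by rintro q ⟨hq1, hq2⟩; exact ⟨hq1.1, hq2⟩) hp
  refine ⟨⟨hp1.1, ?_⟩, hp1.2⟩
  rintro ⟨γ, hγ⟩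
  obtain ⟨N, hN, hinj⟩ := exists_injOn_J (fun h ↦ h0 (h ▸ hp1.2)) (fun h ↦ h1 (h ▸ hp1.2))
  have hN2 : (fun τ : ℍ ↦ γ • τ) ⁻¹' N ∈ 𝓝 p.2 :=
    (continuous_const_smul (γ : GL (Fin 2) ℝ)).continuousAt.preimage_mem_nhds (by
      rw [← hγ] at hN; exact hN)
  have hN3 : N ×ˢ ((fun τ : ℍ ↦ γ • τ) ⁻¹' N) ∈ 𝓝 p := prod_mem_nhds hN hN2
  obtain ⟨⟨a, b⟩, ⟨ha, hb⟩, ⟨hab, hnot⟩, -⟩ := mem_closure_iff_nhds.mp hp _ hN3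
  exact hnot ⟨γ, (hinj _ ha _ hb (by rw [J_smul]; exact hab)).symm⟩

/-- Both points can be moved into the fundamental domain, and bounded `J` bounds the imaginary part.
The set is thus the image of a compact set. -/
lemma isClosed_image_collisions {B : Set ℂ} (hB : IsCompact B) (h0 : (0 : ℂ) ∉ B)
    (h1 : (1 : ℂ) ∉ B) : IsClosed ((fun p : ℍ × ℍ ↦ J p.1) '' collisions ∩ B) := by
  obtain ⟨R, hR⟩ := hB.isBounded.exists_norm_le
  obtain ⟨Y, hY⟩ := exists_im_le_of_norm_J_le R
  have hK := ModularGroup.isCompact_truncatedFundamentalDomain Y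
  have hC := ((hK.prod hK).inter_right (isClosed_collisions hB.isClosed h0 h1)).image
    (f := fun p : ℍ × ℍ ↦ J p.1) (continuous_J.comp continuous_fst)
  convert! hC.isClosed using 1
  ext x
  constructor
  · rintro ⟨⟨⟨z, w⟩, ⟨hzw, hnot⟩, rfl⟩, hx⟩
    obtain ⟨γ, hγ⟩ := ModularGroup.exists_smul_mem_fd z
    obtain ⟨δ, hδ⟩ := ModularGroup.exists_smul_mem_fd w
    dsimp only at hzw hnot hx ⊢
    refine ⟨(γ • z, δ • w), ⟨⟨⟨hγ, hY _ ?_⟩, ⟨hδ, hY _ ?_⟩⟩, ⟨?_, ?_⟩, ?_⟩, J_smul γ z⟩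
    · rw [J_smul]; exact hR _ hx
    · rw [J_smul, ← hzw]; exact hR _ hx
    · simp only [J_smul, hzw]
    · rintro ⟨ε, hε⟩
      refine hnot ⟨γ⁻¹ * ε * δ, ?_⟩
      dsimp only at hε ⊢
      rw [mul_smul, mul_smul, hε, inv_smul_smul]
    · rw [Set.mem_ofPred_eq, J_smul]; exact hx
  · rintro ⟨p, ⟨-, hp1, hp2⟩, rfl⟩
    exact ⟨⟨p, hp1, rfl⟩, hp2⟩

/-- Points at which `J` takes the same value different from `0` and `1` are equivalent. -/
theorem mem_orbit_of_J_eq {z w : ℍ} (h : J z = J w) (h0 : J z ≠ 0) (h1 : J z ≠ 1) :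
    z ∈ MulAction.orbit SL(2, ℤ) w := by
  by_contra hnot
  -- The values taken at inequivalent points form an open and relatively closed subset of the
  -- connected set `ℂ ∖ {0, 1}` which misses all large values, so none lies there.
  set V : Set ℂ := (fun p : ℍ × ℍ ↦ J p.1) '' collisions with hV
  set W : Set ℂ := {0, 1}ᶜ with hW
  have hWo : IsOpen W := (Set.toFinite {(0 : ℂ), 1}).isClosed.isOpen_compl
  have hWc : IsPreconnected W :=
    ((Set.toFinite {(0 : ℂ), 1}).countable.isConnected_compl_of_one_lt_rank
      (by simp [Complex.rank_real_complex])).isPreconnected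
  have hVo : IsOpen V := by
    rw [isOpen_iff_mem_nhds]
    rintro _ ⟨p, hp, rfl⟩
    exact mem_nhds_collision hp
  have hUo : IsOpen (W \ V) := by
    rw [isOpen_iff_mem_nhds]
    rintro x ⟨hxW, hxV⟩
    obtain ⟨B, hB, hBW, hBc⟩ := local_compact_nhds (hWo.mem_nhds hxW)
    have hcl := isClosed_image_collisions hBc (fun h ↦ hBW h (by simp)) (fun h ↦ hBW h (by simp))
    filter_upwards [hB, hcl.isOpen_compl.mem_nhds (x := x) fun h ↦ hxV h.1] with y hy hy'
    exact ⟨hBW hy, fun h ↦ hy' ⟨h, hy⟩⟩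
  have hne1 : (W ∩ V).Nonempty := ⟨J z, by simp [hW, h0, h1], (z, w), ⟨h, hnot⟩, rfl⟩
  obtain ⟨R, hR⟩ := exists_orbit_eq_of_large
  have hne2 : (W ∩ (W \ V)).Nonempty := by
    have hn : ‖((|R| + 2 : ℝ) : ℂ)‖ = |R| + 2 := by
      rw [Complex.norm_real, Real.norm_of_nonneg (by positivity)]
    have hmem : ((|R| + 2 : ℝ) : ℂ) ∈ W := by
      rw [hW, Set.mem_compl_iff, Set.mem_insert_iff, Set.mem_singleton_iff]
      rintro (h | h) <;> rw [h] at hn <;> norm_num at hn <;> linarith [abs_nonneg R]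
    refine ⟨_, hmem, hmem, ?_⟩
    rintro ⟨p, ⟨hp1, hp2⟩, hp⟩
    dsimp only at hp
    exact hp2 (hR _ _ (by rw [hp, hn]; linarith [le_abs_self R]) hp1)
  obtain ⟨x, -, hx1, hx2⟩ := hWc V (W \ V) hVo hUo
    (fun x hx ↦ (em (x ∈ V)).imp id fun h ↦ ⟨hx, h⟩) hne1 hne2
  exact hx2.2 hx1

/-- The value `0` is excluded from `mem_orbit_of_J_eq`, but a collision there would spread to nearby
values other than `0` and `1`. -/
theorem mem_orbit_rho_of_E4_eq_zero {z : ℍ} (h : E4 z = 0) :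
    z ∈ MulAction.orbit SL(2, ℤ) UpperHalfPlane.ρ := by
  by_contra hnot
  have h0 : J z = 0 := (J_eq_zero_iff z).mpr h
  have h1 := mem_nhds_collision (p := (z, UpperHalfPlane.ρ))
    ⟨h0.trans ((J_eq_zero_iff _).mpr E4_rho).symm, hnot⟩
  dsimp only at h1
  rw [h0] at h1
  have h2 : ∀ᶠ x : ℂ in 𝓝[≠] 0, x ∈ (fun p : ℍ × ℍ ↦ J p.1) '' collisions ∧ x ≠ 0 ∧ x ≠ 1 := by
    filter_upwards [nhdsWithin_le_nhds h1, self_mem_nhdsWithin,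
      nhdsWithin_le_nhds (isOpen_ne.mem_nhds (zero_ne_one (α := ℂ)))] with x hx hx0 hx1
    exact ⟨hx, hx0, hx1⟩
  obtain ⟨_, ⟨p, ⟨hp1, hp2⟩, rfl⟩, hx0, hx1⟩ := h2.exists
  exact hp2 (mem_orbit_of_J_eq hp1 hx0 hx1)

end ModularSchwarz
end

noncomputable section

namespace ModularSchwarz

open Filter UpperHalfPlane
open ModularForm (eta E₄ E₆)
open scoped Manifold ModularForm

/-! ### The algebraic system -/

/-- For `P = ∏ (t - xᵢ)` the first sum is `P'/P` and the difference in the last bracket is `P''/P`,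
so this is the hypergeometric equation of `P`, in the manner of Stieltjes. Partial fractions turn
`P''/P` into simple poles, whose residues the system controls. -/
lemma sum_inv_sub_identity {n : ℕ} {x : Fin n → ℂ} (hne : ∀ i j, i ≠ j → x i ≠ x j)
    (h0 : ∀ i, x i ≠ 0) (h1 : ∀ i, x i ≠ 1)
    (hsys : ∀ i, 8 / x i + 3 / (x i - 1) + 12 * ∑ j, (x i - x j)⁻¹ = 0)
    {t : ℂ} (ht : ∀ i, t ≠ x i) :
    (t + 8 / 3 * (t - 1)) * ∑ i, (t - x i)⁻¹ +
      2 * t * (t - 1) * ((∑ i, (t - x i)⁻¹) ^ 2 - ∑ i, (t - x i)⁻¹ ^ 2) =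
      2 * (n : ℂ) ^ 2 + 5 * n / 3 := by
  -- The term `j = i` is `0⁻¹ = 0`.
  set A : Fin n → ℂ := fun i ↦ ∑ j, (x i - x j)⁻¹ with hA
  set u : Fin n → ℂ := fun i ↦ (t - x i)⁻¹ with hu
  have hut : ∀ i, u i * (t - x i) = 1 := fun i ↦ inv_mul_cancel₀ (sub_ne_zero.mpr (ht i))
  have hanti : ∀ G : Fin n → ℂ,
      ∑ i, ∑ j, (x i - x j)⁻¹ * G j = -∑ i, ∑ j, (x i - x j)⁻¹ * G i := fun G ↦ by
    rw [Finset.sum_comm]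
    simp only [← Finset.sum_neg_distrib, ← neg_mul]
    refine Finset.sum_congr rfl fun i _ ↦ Finset.sum_congr rfl fun j _ ↦ ?_
    rw [← inv_neg, neg_sub]
  have hA0 : ∑ i, A i = 0 := by
    have h := hanti fun _ ↦ 1
    simp only [mul_one] at h
    exact self_eq_neg.mp h
  have hA1 : 2 * ∑ i, A i * x i = (n : ℂ) ^ 2 - n := by
    have h2 : ∑ i, ∑ j, ((x i - x j)⁻¹ * x i - (x i - x j)⁻¹ * x j) = (n : ℂ) ^ 2 - n := by
      have h3 : ∀ i j, (x i - x j)⁻¹ * x i - (x i - x j)⁻¹ * x j =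
          1 - if i = j then 1 else 0 := fun i j ↦ by
        split_ifs with hij
        · simp [hij]
        · rw [← mul_sub, inv_mul_cancel₀ (sub_ne_zero.mpr (hne i j hij)), sub_zero]
      simp only [h3, Finset.sum_sub_distrib, Finset.sum_const, Finset.card_univ, Fintype.card_fin,
        Finset.sum_ite_eq, Finset.mem_univ, if_true, nsmul_eq_mul, mul_one, sq]
    simp only [Finset.sum_sub_distrib] at h2
    rw [hanti, sub_neg_eq_add, ← two_mul] at h2
    simpa only [hA, Finset.sum_mul] using h2
  have hS : (∑ i, u i) ^ 2 - ∑ i, u i ^ 2 = 2 * ∑ i, A i * u i := by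
    have h3 : ∀ i j, u i * u j = (x i - x j)⁻¹ * u i - (x i - x j)⁻¹ * u j +
        if i = j then u i ^ 2 else 0 := fun i j ↦ by
      split_ifs with hij
      · simp [hij, sq]
      · have h5 : (x i - x j)⁻¹ * (x i - x j) = 1 :=
          inv_mul_cancel₀ (sub_ne_zero.mpr (hne i j hij))
        linear_combination (-u i * u j) * h5 - (x i - x j)⁻¹ * (u j * hut i - u i * hut j)
    rw [sq, Finset.sum_mul_sum]
    simp only [h3, Finset.sum_add_distrib, Finset.sum_sub_distrib, hanti, Finset.sum_ite_eq,
      Finset.mem_univ, if_true, hA, Finset.sum_mul]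
    ring
  have hAx : ∀ i, x i * (x i - 1) * A i = -(11 * x i - 8) / 12 := fun i ↦ by
    have h := hsys i
    have h2 := sub_ne_zero.mpr (h1 i)
    have h3 := h0 i
    change 8 / x i + 3 / (x i - 1) + 12 * A i = 0 at h
    field_simp at h
    linear_combination h / 12
  rw [hS]
  -- The pole at `t = xᵢ` cancels by `hAx`; `t(t - 1) - xᵢ(xᵢ - 1) = (t - xᵢ)(t + xᵢ - 1)` gives the
  -- polynomial part.
  have key : ∀ i, (t + 8 / 3 * (t - 1)) * u i + 4 * t * (t - 1) * (A i * u i) =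
      4 * (t - 1) * A i + 4 * (A i * x i) + 11 / 3 := fun i ↦ by
    linear_combination (11 / 3 + 4 * A i * (t + x i - 1)) * hut i + 4 * u i * hAx i
  calc _ = ∑ i, ((t + 8 / 3 * (t - 1)) * u i + 4 * t * (t - 1) * (A i * u i)) := by
        rw [Finset.sum_add_distrib, ← Finset.mul_sum, ← Finset.mul_sum]; ring
    _ = 4 * (t - 1) * ∑ i, A i + 4 * ∑ i, A i * x i + n * (11 / 3) := by
        simp only [key, Finset.sum_add_distrib, ← Finset.mul_sum, Finset.sum_const,
          Finset.card_univ, Fintype.card_fin, nsmul_eq_mul]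
    _ = _ := by rw [hA0]; linear_combination 2 * hA1

lemma IsSolution.sum_inv_eq_zero {n : ℕ} {x : Fin n → ℝ} {a b c : ℝ}
    (h : IsSolution a b c x) (i : Fin n) :
    (a : ℂ) / (x i : ℂ) + b / ((x i : ℂ) - 1) + c * ∑ j, ((x i : ℂ) - x j)⁻¹ = 0 := by
  have h1 := h.eq_zero i
  rw [Finset.sum_erase _ (by simp)] at h1
  have h2 := congrArg ((↑) : ℝ → ℂ) h1
  push_cast at h2
  simpa only [Finset.mul_sum, div_eq_mul_inv] using h2

/-! ### The square root of `1 / f` -/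

/-- `y = E₄ ∏ᵢ (J - xᵢ) / η¹⁰`, so that `f = 1 / y²`. -/
def y {n : ℕ} (x : Fin n → ℝ) (z : ℂ) : ℂ := E4 z * (∏ i, (J z - (x i : ℂ))) / eta z ^ 10

lemma f_eq_inv {n : ℕ} (x : Fin n → ℝ) : f x = fun z ↦ (y x z ^ 2)⁻¹ := by
  ext z
  rw [f, y, Finset.prod_pow, div_pow, inv_div, mul_pow, ← pow_mul]

variable {n : ℕ} {x : Fin n → ℝ}

lemma analyticAt_prod_J_sub (s : Finset (Fin n)) (τ : ℍ) :
    AnalyticAt ℂ (fun z ↦ ∏ i ∈ s, (J z - (x i : ℂ))) τ :=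
  Finset.analyticAt_fun_prod _ fun _ _ ↦ (analyticAt_J τ).sub analyticAt_const

lemma analyticAt_y (τ : ℍ) : AnalyticAt ℂ (y x) τ :=
  ((analyticAt_E4 τ).mul (analyticAt_prod_J_sub _ τ)).div ((analyticAt_eta τ).pow 10)
    (eta_pow_ne_zero τ 10)

lemma y_eq_zero_iff (τ : ℍ) : y x τ = 0 ↔ E4 τ = 0 ∨ ∃ i, J τ = x i := by
  simp [y, eta_ne_zero τ, Finset.prod_eq_zero_iff, sub_eq_zero, -E4_coe]

/-- Half the negative logarithmic derivative of `f`, divided by `2πi`. -/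
def logDerivY (x : Fin n → ℝ) (z : ℂ) : ℂ :=
  -(E2c z / 12) - E6 z / E4 z * (1 / 3 + J z * ∑ i, (J z - (x i : ℂ))⁻¹)

lemma hasDerivAt_y {τ : ℍ} (h : y x τ ≠ 0) :
    HasDerivAt (y x) (2 * Real.pi * Complex.I * (y x τ * logDerivY x τ)) τ := by
  have hE : E4 τ ≠ 0 := fun h' ↦ h ((y_eq_zero_iff τ).mpr (.inl h'))
  have hJ : ∀ i, J τ - x i ≠ 0 := fun i h' ↦ h ((y_eq_zero_iff τ).mpr (.inr ⟨i, sub_eq_zero.mp h'⟩))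
  have hη := eta_ne_zero τ
  have hprod : HasDerivAt (fun z ↦ ∏ i, (J z - (x i : ℂ)))
      ((∏ i, (J τ - (x i : ℂ))) * ((∑ i, (J τ - (x i : ℂ))⁻¹) *
        (2 * Real.pi * Complex.I * (-(E4 τ ^ 2 * E6 τ) / (1728 * eta τ ^ 24))))) τ := by
    have h1 := HasDerivAt.fun_finsetProd (u := Finset.univ)
      fun (i : Fin n) _ ↦ (hasDerivAt_J τ).sub_const (x i : ℂ)
    convert! h1 using 1
    rw [Finset.sum_mul, Finset.mul_sum]
    refine Finset.sum_congr rfl fun i hi ↦ ?_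
    rw [← Finset.prod_erase_mul _ _ hi, smul_eq_mul]
    have := mul_inv_cancel₀ (hJ i)
    linear_combination (∏ j ∈ Finset.univ.erase i, (J τ - (x j : ℂ))) *
      (2 * Real.pi * Complex.I * (-(E4 τ ^ 2 * E6 τ) / (1728 * eta τ ^ 24))) * this
  have h2 := ((hasDerivAt_E4 τ).mul hprod).div ((hasDerivAt_eta τ).pow 10) (eta_pow_ne_zero τ 10)
  convert! h2 using 1
  simp only [Pi.pow_apply, Pi.mul_apply]
  rw [logDerivY, y]
  have hJ' : J τ = E4 τ ^ 3 / (1728 * eta τ ^ 24) := rfl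
  generalize (∏ i, (J τ - (x i : ℂ))) = P
  generalize (∑ i, (J τ - (x i : ℂ))⁻¹) = S
  rw [hJ']
  field_simp
  ring

/-- The Riccati form of the linear equation for `y`. It is the only place where the algebraic system
enters the analysis. -/
lemma hasDerivAt_logDerivY (hsol : IsSolution 8 3 12 x) {τ : ℍ} (h : y x τ ≠ 0) :
    HasDerivAt (logDerivY x) (2 * Real.pi * Complex.I *
      ((12 * (n : ℂ) + 5) ^ 2 / 144 * E4 τ - logDerivY x τ ^ 2)) τ := by
  have hE : E4 τ ≠ 0 := fun h' ↦ h ((y_eq_zero_iff τ).mpr (.inl h'))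
  have hJ : ∀ i, J τ - x i ≠ 0 := fun i h' ↦ h ((y_eq_zero_iff τ).mpr (.inr ⟨i, sub_eq_zero.mp h'⟩))
  have hη := eta_ne_zero τ
  have hsum : HasDerivAt (fun z ↦ ∑ i, (J z - (x i : ℂ))⁻¹)
      (-(∑ i, (J τ - (x i : ℂ))⁻¹ ^ 2) *
        (2 * Real.pi * Complex.I * (-(E4 τ ^ 2 * E6 τ) / (1728 * eta τ ^ 24)))) τ := by
    have h1 := HasDerivAt.fun_sum (u := Finset.univ)
      fun (i : Fin n) _ ↦ ((hasDerivAt_J τ).sub_const (x i : ℂ)).inv (hJ i)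
    convert! h1 using 1
    rw [← Finset.sum_neg_distrib, Finset.sum_mul]
    refine Finset.sum_congr rfl fun i hi ↦ ?_
    rw [inv_pow]
    ring
  have h2 := ((hasDerivAt_E2c τ).div_const 12).neg.sub
    (((hasDerivAt_E6 τ).div (hasDerivAt_E4 τ) hE).mul
      (((hasDerivAt_J τ).mul hsum).const_add (1 / 3)))
  convert! h2 using 1
  have hid := sum_inv_sub_identity (x := fun i ↦ (x i : ℂ)) (t := J τ)
    (fun i j hij h ↦ hsol.ne_of_ne i j hij (by exact_mod_cast h))
    (fun i ↦ by exact_mod_cast hsol.ne_zero i) (fun i ↦ by exact_mod_cast hsol.ne_one i)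
    (fun i ↦ by simpa using hsol.sum_inv_eq_zero i) (fun i ↦ sub_ne_zero.mp (hJ i))
  simp only [Pi.div_apply, Pi.mul_apply]
  have hJ' : J τ = E4 τ ^ 3 / (1728 * eta τ ^ 24) := rfl
  have hΔ : E6 τ ^ 2 = E4 τ ^ 3 - 1728 * eta τ ^ 24 := by
    linear_combination -E4_cube_sub_E6_sq τ
  rw [logDerivY]
  generalize (∑ i, (J τ - (x i : ℂ))⁻¹) = S at *
  generalize (∑ i, (J τ - (x i : ℂ))⁻¹ ^ 2) = S2 at *
  have hJ0 : J τ ≠ 0 := by rwa [Ne, J_eq_zero_iff]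
  have hd : 1728 * eta τ ^ 24 = E4 τ ^ 3 / J τ := by
    rw [eq_div_iff hJ0, hJ', mul_div_cancel₀]
    exact mul_ne_zero (by norm_num) (eta_pow_ne_zero τ 24)
  rw [hd] at hΔ ⊢
  generalize J τ = t at *
  generalize E4 τ = a at *
  generalize E6 τ = b at *
  generalize E2c τ = c at *
  clear hJ' h2 hsum hd
  -- In terms of `r = E₆ / E₄`, the definition of `J` and the discriminant formula leave one
  -- relation, `r² J = E₄ (J - 1)`.
  obtain ⟨r, rfl⟩ : ∃ r, b = r * a := ⟨b / a, (div_mul_cancel₀ _ hE).symm⟩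
  have hr : r ^ 2 * t = a * (t - 1) := by
    field_simp at hΔ
    exact hΔ
  have main : (12 * (n : ℂ) + 5) ^ 2 / 144 * a - (-(c / 12) - r * (1 / 3 + t * S)) ^ 2 =
      -((c ^ 2 - a) / 144) - ((c * r / 6 - a / 2 + r ^ 2 / 3) * (1 / 3 + t * S) -
        r ^ 2 * t * (S - t * S2)) := by
    linear_combination -(4 / 3 * S + t * (S ^ 2 - S2)) * hr - a / 2 * hid
  rw [mul_div_cancel_right₀ r hE, main]
  field_simp
  ring

/-- The function `y` solves the linear differential equation `y'' + (C / 2) E₄ y = 0`. -/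
lemma deriv_deriv_y (hsol : IsSolution 8 3 12 x) {τ : ℍ} (h : y x τ ≠ 0) :
    deriv (deriv (y x)) τ =
      -(Real.pi : ℂ) ^ 2 * ((12 * (n : ℂ) + 5) / 6) ^ 2 * E4 τ * y x τ := by
  have h1 : deriv (y x) =ᶠ[𝓝 (τ : ℂ)]
      fun z ↦ 2 * Real.pi * Complex.I * (y x z * logDerivY x z) := by
    filter_upwards [isOpen_upperHalfPlaneSet.mem_nhds τ.2,
      (analyticAt_y τ).continuousAt.eventually_ne h] with z hz hyz
    exact (hasDerivAt_y (τ := ⟨z, hz⟩) hyz).deriv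
  rw [h1.deriv_eq]
  refine (((hasDerivAt_y h).mul (hasDerivAt_logDerivY hsol h)).const_mul
    (2 * Real.pi * Complex.I)).deriv.trans ?_
  linear_combination 4 * (Real.pi : ℂ) ^ 2 * ((12 * (n : ℂ) + 5) ^ 2 / 144 * E4 τ) * y x τ *
    Complex.I_sq

/-! ### Simplicity and location of the zeros of `y` -/

lemma deriv_ne_zero_of_eq_mul {u g F : ℂ → ℂ} {p : ℂ} (hF : F = fun z ↦ u z * g z)
    (hu : DifferentiableAt ℂ u p) (hg : DifferentiableAt ℂ g p) (hu0 : u p = 0)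
    (hu1 : deriv u p ≠ 0) (hg0 : g p ≠ 0) : deriv F p ≠ 0 := by
  rw [hF, deriv_fun_mul hu hg, hu0, zero_mul, add_zero]
  exact mul_ne_zero hu1 hg0

/-- `E₄` and `E₆` have no common zero because `η` has none, and `J' ≠ 0` where `J = xᵢ` avoids `0`
and `1`. Distinctness of the `xᵢ` and `xᵢ ≠ 0` keep the factors of `y` from vanishing together. -/
lemma deriv_y_ne_zero (hx : ∀ i, x i ∈ Set.Ioo (0 : ℝ) 1) (hne : ∀ i j, i ≠ j → x i ≠ x j)
    {τ : ℍ} (h : y x τ = 0) : deriv (y x) τ ≠ 0 := by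
  have hη := eta_pow_ne_zero τ 10
  have hηa := (analyticAt_eta τ).pow 10
  rcases (y_eq_zero_iff τ).mp h with hE | ⟨i, hi⟩
  · refine deriv_ne_zero_of_eq_mul (u := E4)
      (g := fun z ↦ (∏ i, (J z - (x i : ℂ))) / eta z ^ 10)
      (by ext z; rw [y, mul_div_assoc]) (analyticAt_E4 τ).differentiableAt
      ((analyticAt_prod_J_sub _ τ).div hηa hη).differentiableAt hE ?_ ?_
    · rw [(hasDerivAt_E4 τ).deriv, hE]
      have h6 : E6 τ ≠ 0 := fun h6 ↦ by
        have := E4_cube_sub_E6_sq τ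
        rw [hE, h6] at this
        exact eta_pow_ne_zero τ 24 (by linear_combination -this / 1728)
      simp [h6, -E6_coe]
    · refine div_ne_zero (Finset.prod_ne_zero_iff.mpr fun i _ ↦ ?_) hη
      rw [(J_eq_zero_iff τ).mpr hE, zero_sub, neg_ne_zero]
      exact_mod_cast (hx i).1.ne'
  · have hJ0 : J τ ≠ 0 := by rw [hi]; exact_mod_cast (hx i).1.ne'
    have hJ1 : J τ ≠ 1 := by rw [hi]; exact_mod_cast (hx i).2.ne
    refine deriv_ne_zero_of_eq_mul (u := fun z ↦ J z - (x i : ℂ))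
      (g := fun z ↦ E4 z * (∏ j ∈ Finset.univ.erase i, (J z - (x j : ℂ))) / eta z ^ 10)
      ?_ ((analyticAt_J τ).sub analyticAt_const).differentiableAt
      (((analyticAt_E4 τ).mul (analyticAt_prod_J_sub _ τ)).div hηa hη).differentiableAt
      (sub_eq_zero.mpr hi) ?_ ?_
    · ext z
      rw [y, ← Finset.mul_prod_erase _ _ (Finset.mem_univ i)]
      ring
    · rw [deriv_sub_const]
      exact deriv_J_ne_zero hJ0 hJ1
    · refine div_ne_zero (mul_ne_zero (by rwa [Ne, ← J_eq_zero_iff])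
        (Finset.prod_ne_zero_iff.mpr fun j hj ↦ ?_)) hη
      rw [hi, sub_ne_zero]
      exact_mod_cast hne i j (Finset.ne_of_mem_erase hj).symm

lemma y_eq_zero_iff_mem_poleSet (hx : ∀ i, x i ∈ Set.Ioo (0 : ℝ) 1) {w : Fin n → ℍ}
    (hw : ∀ i, J (w i : ℂ) = (x i : ℂ)) (τ : ℍ) : y x τ = 0 ↔ τ ∈ poleSet w := by
  rw [y_eq_zero_iff]
  constructor
  · rintro (hE | ⟨i, hi⟩)
    · exact .inl (mem_orbit_rho_of_E4_eq_zero hE)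
    · refine .inr ⟨i, mem_orbit_of_J_eq (hi.trans (hw i).symm) ?_ ?_⟩ <;> rw [hi]
      · exact_mod_cast (hx i).1.ne'
      · exact_mod_cast (hx i).2.ne
  · rintro (hτ | ⟨i, hi⟩)
    · exact .inl ((J_eq_zero_iff τ).mp
        ((J_eq_of_mem_orbit hτ).trans ((J_eq_zero_iff _).mpr E4_rho)))
    · exact .inr ⟨i, (J_eq_of_mem_orbit hi).trans (hw i)⟩

/-- Countability lets `exists_isC1Path` produce paths that avoid the poles. -/
lemma countable_poleSet (w : Fin n → ℍ) : (poleSet w).Countable := by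
  have h : ∀ z : ℍ, (MulAction.orbit SL(2, ℤ) z).Countable := fun z ↦ by
    have : Countable (Matrix (Fin 2) (Fin 2) ℤ) :=
      inferInstanceAs (Countable (Fin 2 → Fin 2 → ℤ))
    have : Countable SL(2, ℤ) := Subtype.countable
    exact Set.countable_range _
  have h2 : poleSet w = MulAction.orbit SL(2, ℤ) UpperHalfPlane.ρ ∪
      ⋃ i, MulAction.orbit SL(2, ℤ) (w i) := by
    ext τ
    simp [poleSet]
  rw [h2]
  exact (h _).union (Set.countable_iUnion fun i ↦ h _)

end ModularSchwarz
end

noncomputable section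

namespace ModularSchwarz

open Filter UpperHalfPlane

/-! ### Double poles without residue -/

lemma analyticAt_dslope {u : ℂ → ℂ} {p : ℂ} (hu : AnalyticAt ℂ u p) :
    AnalyticAt ℂ (dslope u p) p := by
  obtain ⟨s, hs⟩ := hu
  exact hs.has_fpower_series_dslope_fslope.analyticAt

/-- If `u` has a simple zero at `p` and `u''(p) = 0`, then `1 / u²` has no residue at `p`. -/
lemma exists_principal_part {u : ℂ → ℂ} {p : ℂ} (hu : AnalyticAt ℂ u p) (h0 : u p = 0)
    (h1 : deriv u p ≠ 0) (h2 : deriv (deriv u) p = 0) :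
    ∃ c ≠ 0, ∃ R, AnalyticAt ℂ R p ∧
      ∀ z ≠ p, (u z ^ 2)⁻¹ = c * ((z - p) ^ 2)⁻¹ + R z := by
  set k := dslope u p with hk
  have hka : AnalyticAt ℂ k p := analyticAt_dslope hu
  have hk0 : k p ≠ 0 := by rwa [hk, dslope_same]
  have huk : ∀ z, u z = (z - p) * k z := fun z ↦ by
    have := sub_smul_dslope u p z
    rw [h0, sub_zero, smul_eq_mul] at this
    exact this.symm
  -- From `u = (z - p) k` one gets `u''(p) = 2 k'(p)`.
  have hk1 : deriv k p = 0 := by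
    have hd : deriv u =ᶠ[𝓝 p] fun z ↦ k z + (z - p) * deriv k z := by
      filter_upwards [hka.eventually_analyticAt] with z hz
      have h3 := ((hasDerivAt_id z).sub_const p).mul hz.differentiableAt.hasDerivAt
      rw [show u = fun z ↦ (z - p) * k z from funext huk]
      refine h3.deriv.trans ?_
      simp
    have h3 := hka.differentiableAt.hasDerivAt.add
      (((hasDerivAt_id p).sub_const p).mul hka.deriv.differentiableAt.hasDerivAt)
    have h4 := hd.deriv_eq.symm.trans h2
    have h5 := h3.deriv.symm.trans h4
    simp only [id, sub_self, zero_mul, add_zero, one_mul] at h5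
    exact self_eq_neg.mp (eq_neg_of_add_eq_zero_left h5)
  set G : ℂ → ℂ := fun z ↦ (k z ^ 2)⁻¹ with hG
  have hGa : AnalyticAt ℂ G p := (hka.pow 2).inv (pow_ne_zero 2 hk0)
  have hG1 : dslope G p p = 0 := by
    have h3 := (hka.differentiableAt.hasDerivAt.pow 2).inv (pow_ne_zero 2 hk0)
    rw [dslope_same]
    refine h3.deriv.trans ?_
    simp [hk1]
  -- Since `G'(p) = 0`, the second difference quotient `R` satisfies `G = G(p) + (z - p)² R`.
  refine ⟨G p, inv_ne_zero (pow_ne_zero 2 hk0), dslope (dslope G p) p,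
    analyticAt_dslope (analyticAt_dslope hGa), fun z hz ↦ ?_⟩
  have e1 := sub_smul_dslope G p z
  have e2 := sub_smul_dslope (dslope G p) p z
  rw [hG1, sub_zero] at e2
  rw [← e2, smul_eq_mul, smul_eq_mul] at e1
  have hzp := sub_ne_zero.mpr hz
  have e3 : (u z ^ 2)⁻¹ = ((z - p) ^ 2)⁻¹ * G z := by
    rw [huk, mul_pow, mul_inv]
  rw [e3]
  field_simp
  linear_combination -e1

/-- A function on the upper half-plane with countably many zeros, all of them simple, at which
the second derivative vanishes. -/
structure HasInflectionZeros (u : ℂ → ℂ) : Prop where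
  analyticAt : ∀ z, 0 < z.im → AnalyticAt ℂ u z
  deriv_ne_zero : ∀ z, 0 < z.im → u z = 0 → deriv u z ≠ 0
  deriv_deriv : ∀ z, 0 < z.im → u z = 0 → deriv (deriv u) z = 0
  countable : {z : ℂ | 0 < z.im ∧ u z = 0}.Countable

namespace HasInflectionZeros

variable {u : ℂ → ℂ}

lemma exists_principal_part (hu : HasInflectionZeros u) {p : ℂ} (hp : 0 < p.im) (h0 : u p = 0) :
    ∃ c ≠ 0, ∃ R, AnalyticAt ℂ R p ∧ ∀ z ≠ p, (u z ^ 2)⁻¹ = c * ((z - p) ^ 2)⁻¹ + R z :=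
  ModularSchwarz.exists_principal_part (hu.analyticAt p hp) h0 (hu.deriv_ne_zero p hp h0)
    (hu.deriv_deriv p hp h0)

lemma analyticAt_inv_sq (hu : HasInflectionZeros u) {z : ℂ} (hz : 0 < z.im) (h0 : u z ≠ 0) :
    AnalyticAt ℂ (fun z ↦ (u z ^ 2)⁻¹) z :=
  ((hu.analyticAt z hz).pow 2).inv (pow_ne_zero 2 h0)

lemma eventually_ne_zero (hu : HasInflectionZeros u) {p : ℂ} (hp : 0 < p.im) :
    ∀ᶠ z in 𝓝[≠] p, u z ≠ 0 := by
  by_cases h0 : u p = 0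
  · exact ((hu.analyticAt p hp).differentiableAt.hasDerivAt.eventually_ne
      (hu.deriv_ne_zero p hp h0))
  · exact ((hu.analyticAt p hp).continuousAt.eventually_ne h0).filter_mono nhdsWithin_le_nhds

lemma meromorphicOrderAt_eq (hu : HasInflectionZeros u) {p : ℂ} (hp : 0 < p.im) (h0 : u p = 0) :
    meromorphicOrderAt (fun z ↦ (u z ^ 2)⁻¹) p = -2 := by
  obtain ⟨c, hc, R, hR, h⟩ := hu.exists_principal_part hp h0
  have hm : MeromorphicAt (fun z ↦ (u z ^ 2)⁻¹) p :=
    ((hu.analyticAt p hp).meromorphicAt.pow 2).inv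
  refine (meromorphicOrderAt_eq_int_iff hm (n := -2)).mpr
    ⟨fun z ↦ c + (z - p) ^ 2 * R z, ?_, by simpa using hc, ?_⟩
  · exact analyticAt_const.add (((analyticAt_id.sub analyticAt_const).pow 2).mul hR)
  · filter_upwards [self_mem_nhdsWithin] with z hz
    have hzp := sub_ne_zero.mpr hz
    rw [h z hz, smul_eq_mul, zpow_neg]
    norm_cast
    field_simp

lemma hasResidueAt (hu : HasInflectionZeros u) {p : ℂ} (hp : 0 < p.im) (h0 : u p = 0) :
    HasResidueAt (fun z ↦ (u z ^ 2)⁻¹) p 0 := by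
  obtain ⟨c, hc, R, hR, h⟩ := hu.exists_principal_part hp h0
  obtain ⟨ε, hε, hball⟩ := Metric.eventually_nhds_iff_ball.mp hR.eventually_analyticAt
  filter_upwards [Ioo_mem_nhdsGT hε] with r hr
  have hsub : ∀ z ∈ Metric.closedBall p r, AnalyticAt ℂ R z := fun z hz ↦
    hball z (Metric.closedBall_subset_ball hr.2 hz)
  have hcont : ContinuousOn R (Metric.closedBall p r) := fun z hz ↦
    (hsub z hz).continuousAt.continuousWithinAt
  have hcong : (∮ z in C(p, r), (u z ^ 2)⁻¹) =
      ∮ z in C(p, r), (c * (z - p) ^ (-2 : ℤ) + R z) := by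
    refine circleIntegral.integral_congr hr.1.le fun z hz ↦ ?_
    have hzp : z ≠ p := by
      rintro rfl
      rw [mem_sphere_iff_norm, sub_self, norm_zero] at hz
      exact hr.1.ne hz
    rw [h z hzp, zpow_neg]
    norm_cast
  have hi1 : CircleIntegrable (fun z ↦ c * (z - p) ^ (-2 : ℤ)) p r := by
    refine ContinuousOn.circleIntegrable hr.1.le fun z hz ↦ ContinuousAt.continuousWithinAt ?_
    have hzp : z - p ≠ 0 := by
      rw [← norm_pos_iff, mem_sphere_iff_norm.mp hz]; exact hr.1
    exact continuousAt_const.mul ((continuousAt_id.sub continuousAt_const).zpow₀ _ (.inl hzp))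
  have hi2 : CircleIntegrable R p r :=
    (hcont.mono Metric.sphere_subset_closedBall).circleIntegrable hr.1.le
  rw [hcong, circleIntegral.integral_add hi1 hi2, circleIntegral.integral_const_mul,
    circleIntegral.integral_sub_zpow_of_ne (by norm_num),
    Complex.circleIntegral_eq_zero_of_differentiable_on_off_countable hr.1.le
      Set.countable_empty hcont
      fun z hz ↦ (hsub z (Metric.ball_subset_closedBall hz.1)).differentiableAt]
  simp

lemma finite_zeros (hu : HasInflectionZeros u) {K : Set ℂ} (hK : IsCompact K)
    (hKH : ∀ z ∈ K, 0 < z.im) : (K ∩ {z | u z = 0}).Finite := by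
  by_contra hinf
  obtain ⟨p, hpK, hp⟩ := Set.Infinite.exists_accPt_of_subset_isCompact hinf hK
    Set.inter_subset_left
  rw [accPt_iff_frequently_nhdsNE] at hp
  exact hp ((hu.eventually_ne_zero (hKH p hpK)).mono fun z hz hz' ↦ hz hz'.2)

/-! ### Primitives -/

/-- A function with removable singularities at the points of `U` agrees there with a holomorphic
function. -/
lemma _root_.ModularSchwarz.exists_differentiableOn_of_removable {F : ℂ → ℂ} {U : Set ℂ}
    (h : ∀ p ∈ U, ∃ R, AnalyticAt ℂ R p ∧ F =ᶠ[𝓝[≠] p] R) :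
    ∃ F₁, DifferentiableOn ℂ F₁ U ∧ ∀ p ∈ U, ContinuousAt F p → F₁ p = F p := by
  refine ⟨fun z ↦ limUnder (𝓝[≠] z) F, fun p hp ↦ ?_, fun p hp hc ↦ ?_⟩
  · obtain ⟨R, hR, hFR⟩ := h p hp
    have hlim : ∀ z, ContinuousAt R z → F =ᶠ[𝓝[≠] z] R → limUnder (𝓝[≠] z) F = R z :=
      fun z hz hz' ↦ ((hz.tendsto.mono_left nhdsWithin_le_nhds).congr' hz'.symm).limUnder_eq
    have hev : ∀ᶠ z in 𝓝[≠] p, limUnder (𝓝[≠] z) F = R z := by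
      have h2 : ∀ᶠ z in 𝓝[≠] p, F =ᶠ[𝓝 z] R := by
        have h3 := eventually_eventually_nhdsWithin.mpr hFR
        filter_upwards [h3, self_mem_nhdsWithin] with z hz hzp
        rwa [isOpen_compl_singleton.nhdsWithin_eq hzp] at hz
      filter_upwards [h2, hR.eventually_analyticAt.filter_mono nhdsWithin_le_nhds] with z hz hz'
      exact hlim z hz'.continuousAt (hz.filter_mono nhdsWithin_le_nhds)
    have hev' : (fun z ↦ limUnder (𝓝[≠] z) F) =ᶠ[𝓝 p] R := by
      rw [← nhdsNE_sup_pure]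
      exact eventually_sup.mpr ⟨hev, hlim p hR.continuousAt hFR⟩
    exact (hR.differentiableAt.congr_of_eventuallyEq hev').differentiableWithinAt
  · exact (hc.tendsto.mono_left nhdsWithin_le_nhds).limUnder_eq

/-- Subtracting the finitely many principal parts leaves a function holomorphic on the disc, which
has a primitive. With no residues, each part integrates to `-a / (z - p)` without a logarithm. -/
lemma exists_primitive (hu : HasInflectionZeros u) {c : ℂ} {r : ℝ}
    (hH : ∀ z ∈ Metric.closedBall c r, 0 < z.im) :
    ∃ H : ℂ → ℂ, (∀ z ∈ Metric.ball c r, u z ≠ 0 → HasDerivAt H (u z ^ 2)⁻¹ z) ∧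
      ∀ z ∈ Metric.ball c r, MeromorphicAt H z := by
  classical
  have hfin := hu.finite_zeros (isCompact_closedBall c r) hH
  set S := hfin.toFinset with hS
  have hSmem : ∀ p, p ∈ S ↔ p ∈ Metric.closedBall c r ∧ u p = 0 := fun p ↦ by
    rw [hS, Set.Finite.mem_toFinset]; rfl
  have hex : ∀ p : ℂ, ∃ a : ℂ, ∃ R, p ∈ S → AnalyticAt ℂ R p ∧
      ∀ z ≠ p, (u z ^ 2)⁻¹ = a * ((z - p) ^ 2)⁻¹ + R z := fun p ↦ by
    by_cases hp : p ∈ S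
    · obtain ⟨a, -, R, hR⟩ := hu.exists_principal_part (hH p ((hSmem p).mp hp).1)
        ((hSmem p).mp hp).2
      exact ⟨a, R, fun _ ↦ hR⟩
    · exact ⟨0, 0, fun h ↦ absurd h hp⟩
  choose a R haR using hex
  have hterm : ∀ p z : ℂ, z ≠ p → AnalyticAt ℂ (fun z ↦ a p * ((z - p) ^ 2)⁻¹) z := fun p z hz ↦
    analyticAt_const.mul (((analyticAt_id.sub analyticAt_const).pow 2).inv
      (pow_ne_zero 2 (sub_ne_zero.mpr hz)))
  have hreg : ∀ z ∈ Metric.ball c r, u z ≠ 0 → z ∉ S := fun z _ h0 hzS ↦ h0 ((hSmem z).mp hzS).2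
  have hsumreg : ∀ (T : Finset ℂ) (z : ℂ), z ∉ T →
      AnalyticAt ℂ (fun z ↦ ∑ p ∈ T, a p * ((z - p) ^ 2)⁻¹) z := fun T z hz ↦
    Finset.analyticAt_fun_sum _ fun p hp ↦ hterm p z fun h ↦ hz (h ▸ hp)
  have hFan : ∀ z ∈ Metric.ball c r, u z ≠ 0 →
      AnalyticAt ℂ (fun z ↦ (u z ^ 2)⁻¹ - ∑ p ∈ S, a p * ((z - p) ^ 2)⁻¹) z := fun z hz h0 ↦
    (hu.analyticAt_inv_sq (hH z (Metric.ball_subset_closedBall hz)) h0).sub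
      (hsumreg S z (hreg z hz h0))
  obtain ⟨F₁, hF₁, hFeq⟩ := exists_differentiableOn_of_removable
    (F := fun z ↦ (u z ^ 2)⁻¹ - ∑ p ∈ S, a p * ((z - p) ^ 2)⁻¹) (U := Metric.ball c r) (by
      intro p hp
      by_cases h0 : u p = 0
      · have hpS : p ∈ S := (hSmem p).mpr ⟨Metric.ball_subset_closedBall hp, h0⟩
        obtain ⟨hR1, hR2⟩ := haR p hpS
        refine ⟨fun z ↦ R p z - ∑ q ∈ S.erase p, a q * ((z - q) ^ 2)⁻¹,
          hR1.sub (hsumreg _ p (Finset.notMem_erase p S)), ?_⟩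
        filter_upwards [self_mem_nhdsWithin] with z hz
        rw [hR2 z hz, ← Finset.add_sum_erase _ _ hpS]
        ring
      · exact ⟨_, hFan p hp h0, EventuallyEq.rfl⟩)
  obtain ⟨H₁, hH₁⟩ := hF₁.isExactOn_ball
  refine ⟨fun z ↦ H₁ z - ∑ p ∈ S, a p * (z - p)⁻¹, fun z hz h0 ↦ ?_, fun z hz ↦ ?_⟩
  · have hzS := hreg z hz h0
    have h1 : HasDerivAt (fun z ↦ ∑ p ∈ S, a p * (z - p)⁻¹)
        (∑ p ∈ S, a p * (-1 / (z - p) ^ 2)) z := by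
      refine HasDerivAt.fun_sum fun p hp ↦ ?_
      have hzp : z ≠ p := fun h ↦ hzS (h ▸ hp)
      exact (((hasDerivAt_id z).sub_const p).inv (sub_ne_zero.mpr hzp)).const_mul (a p)
    convert! (hH₁ z hz).sub h1 using 1
    have h2 : ∑ p ∈ S, a p * (-1 / (z - p) ^ 2) = -∑ p ∈ S, a p * ((z - p) ^ 2)⁻¹ := by
      rw [← Finset.sum_neg_distrib]
      exact Finset.sum_congr rfl fun p _ ↦ by rw [neg_div, one_div, mul_neg]
    rw [hFeq z hz (hFan z hz h0).continuousAt, h2]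
    ring
  · have hd : DifferentiableOn ℂ H₁ (Metric.ball c r) := fun z hz ↦
      (hH₁ z hz).differentiableAt.differentiableWithinAt
    refine (hd.analyticAt (Metric.isOpen_ball.mem_nhds hz)).meromorphicAt.sub ?_
    refine MeromorphicAt.fun_sum fun p _ ↦ ?_
    exact (MeromorphicAt.const _ _).mul ((MeromorphicAt.id z).sub (MeromorphicAt.const _ _)).inv

end HasInflectionZeros

/-! ### Paths -/

/-- Large discs centred high on the imaginary axis exhaust the half-plane, so primitives on discs
suffice for arbitrary paths. -/
lemma exists_ball_supset {K : Set ℂ} (hK : IsCompact K) (hKH : ∀ z ∈ K, 0 < z.im) :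
    ∃ (c : ℂ) (r : ℝ), (∀ z ∈ Metric.closedBall c r, 0 < z.im) ∧ K ⊆ Metric.ball c r := by
  rcases K.eq_empty_or_nonempty with rfl | hne
  · exact ⟨0, -1, by simp, Set.empty_subset _⟩
  obtain ⟨R, hR⟩ := hK.isBounded.exists_norm_le
  obtain ⟨z₀, hz₀, hmin⟩ := hK.exists_isMinOn hne Complex.continuous_im.continuousOn
  set δ := z₀.im with hδ
  have hδ0 : 0 < δ := hKH z₀ hz₀
  -- The centre is `iM` and the radius `M - δ/2`. Containment of `K` reduces to `R² < Mδ + δ²/4`.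
  set M := (R ^ 2 + 1) / δ + δ with hM
  have hMδ : M * δ = R ^ 2 + 1 + δ ^ 2 := by rw [hM]; field_simp
  have hM0 : δ ≤ M := by
    rw [hM]; linarith [show 0 ≤ (R ^ 2 + 1) / δ by positivity]
  refine ⟨⟨0, M⟩, M - δ / 2, fun z hz ↦ ?_, fun z hz ↦ ?_⟩
  · rw [mem_closedBall_iff_norm] at hz
    have := (Complex.abs_im_le_norm _).trans hz
    rw [Complex.sub_im] at this
    linarith [neg_abs_le (z.im - M)]
  · have hzR := hR z hz
    have hzδ : δ ≤ z.im := hmin hz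
    have hn : ‖z‖ ^ 2 ≤ R ^ 2 := pow_le_pow_left₀ (norm_nonneg _) hzR 2
    rw [mem_ball_iff_norm]
    refine lt_of_pow_lt_pow_left₀ 2 (by linarith) ?_
    rw [← Complex.normSq_eq_norm_sq, Complex.normSq_apply] at hn ⊢
    simp only [Complex.sub_re, Complex.sub_im, sub_zero]
    nlinarith [mul_le_mul_of_nonneg_left hzδ (hδ0.le.trans hM0)]

/-- Two points of a convex open set can be joined by a `C¹` path that avoids a given countable
set. -/
lemma exists_isC1Path {U Z : Set ℂ} (hU : IsOpen U) (hc : Convex ℝ U) (hZ : Z.Countable) {a b : ℂ}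
    (ha : a ∈ U) (hb : b ∈ U) (haZ : a ∉ Z) (hbZ : b ∉ Z) :
    ∃ γ, IsC1Path (U \ Z) a b γ := by
  rcases eq_or_ne a b with rfl | hab
  · exact ⟨fun _ ↦ a, contDiff_const, rfl, rfl, fun _ _ ↦ ⟨ha, haZ⟩⟩
  have hba : b - a ≠ 0 := sub_ne_zero.mpr hab.symm
  -- A family of arcs from `a` to `b`, bulging sideways in proportion to `s`. Distinct arcs meet
  -- only at the endpoints, so each point of `Z` spoils at most one `s`.
  set g : ℝ → ℝ → ℂ := fun s t ↦ a + (b - a) * (t + s * (t * (1 - t)) * Complex.I) with hg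
  have hgU : ∀ᶠ s in 𝓝 (0 : ℝ), ∀ t ∈ Set.Icc (0 : ℝ) 1, g s t ∈ U := by
    refine isCompact_Icc.eventually_forall_of_forall_eventually fun t ht ↦ ?_
    have hcont : Continuous fun p : ℝ × ℝ ↦ g p.1 p.2 := by
      simp only [hg]; fun_prop
    refine hcont.continuousAt.eventually_mem (hU.mem_nhds ?_)
    have : g 0 t = a + t • (b - a) := by simp [hg]; ring
    rw [this]
    exact hc.add_smul_sub_mem ha hb ht
  set B : Set ℝ := {s | ∃ t ∈ Set.Ioo (0 : ℝ) 1, g s t ∈ Z} with hB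
  have hBc : B.Countable := by
    set T : ℂ → ℝ := fun z ↦ ((z - a) / (b - a)).re with hT
    set σ : ℂ → ℝ := fun z ↦ ((z - a) / (b - a)).im / (T z * (1 - T z)) with hσ
    refine (hZ.image σ).mono ?_
    rintro s ⟨t, ht, hst⟩
    refine ⟨g s t, hst, ?_⟩
    have h1 : (g s t - a) / (b - a) = t + s * (t * (1 - t)) * Complex.I := by
      simp only [hg]; field_simp; ring
    have h2 : T (g s t) = t := by
      simp only [hT, h1]
      norm_cast
      simp
    have h3 : ((g s t - a) / (b - a)).im = s * (t * (1 - t)) := by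
      rw [h1]
      norm_cast
      simp
    have h4 : t * (1 - t) ≠ 0 := mul_ne_zero ht.1.ne' (sub_ne_zero.mpr ht.2.ne')
    simp only [hσ, h2, h3]
    exact mul_div_cancel_right₀ s h4
  obtain ⟨ε, hε, hball⟩ := Metric.eventually_nhds_iff_ball.mp hgU
  obtain ⟨s, hsB, hs⟩ : (Bᶜ ∩ Metric.ball 0 ε).Nonempty :=
    (hBc.dense_compl ℝ).inter_open_nonempty _ Metric.isOpen_ball ⟨0, Metric.mem_ball_self hε⟩ |>.mono
      (by rw [Set.inter_comm])
  refine ⟨g s, ?_, by simp [hg], by simp [hg], fun t ht ↦ ⟨hball s hs t ht, fun htZ ↦ ?_⟩⟩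
  · simp only [hg]
    have h1 : ContDiff ℝ 1 (fun t : ℝ ↦ (t : ℂ)) := Complex.ofRealCLM.contDiff
    fun_prop
  · rcases eq_or_ne t 0 with rfl | h0
    · exact haZ (by simpa [hg] using htZ)
    rcases eq_or_ne t 1 with rfl | h1
    · exact hbZ (by simpa [hg] using htZ)
    exact hsB ⟨t, ⟨lt_of_le_of_ne ht.1 h0.symm, lt_of_le_of_ne ht.2 h1⟩, htZ⟩

lemma integral_path_eq_sub {F H : ℂ → ℂ} {V : Set ℂ} (hF : ContinuousOn F V)
    (hH : ∀ z ∈ V, HasDerivAt H (F z) z) {a b : ℂ} {γ : ℝ → ℂ} (hγ : IsC1Path V a b γ) :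
    ∫ t in (0 : ℝ)..1, F (γ t) * deriv γ t = H b - H a := by
  have hmem : ∀ t ∈ Set.uIcc (0 : ℝ) 1, γ t ∈ V := fun t ht ↦
    hγ.mem t (by rwa [Set.uIcc_of_le zero_le_one] at ht)
  rw [intervalIntegral.integral_eq_sub_of_hasDerivAt (f := fun t ↦ H (γ t)), hγ.source, hγ.target]
  · intro t ht
    have h1 : HasDerivAt γ (deriv γ t) t :=
      (hγ.contDiff.differentiable one_ne_zero t).hasDerivAt
    exact (hH _ (hmem t ht)).comp t h1
  · refine ContinuousOn.intervalIntegrable (ContinuousOn.mul ?_ ?_)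
    · exact hF.comp hγ.contDiff.continuous.continuousOn hmem
    · exact (hγ.contDiff.continuous_deriv le_rfl).continuousOn

/-! ### Path integrals of `1 / u²` and the Schwarz derivative -/

namespace HasInflectionZeros

variable {u : ℂ → ℂ}

lemma regularSet_eq (hu : HasInflectionZeros u) :
    regularSet (fun z ↦ (u z ^ 2)⁻¹) = {z | 0 < z.im ∧ u z ≠ 0} := by
  ext z
  refine ⟨fun ⟨hz, han⟩ ↦ ⟨hz, fun h0 ↦ ?_⟩, fun ⟨hz, h0⟩ ↦ ⟨hz, hu.analyticAt_inv_sq hz h0⟩⟩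
  have h1 := han.meromorphicOrderAt_nonneg
  rw [hu.meromorphicOrderAt_eq hz h0] at h1
  exact absurd h1 (by decide)

lemma continuousOn_inv_sq (hu : HasInflectionZeros u) :
    ContinuousOn (fun z ↦ (u z ^ 2)⁻¹) {z | 0 < z.im ∧ u z ≠ 0} := fun _ hz ↦
  (hu.analyticAt_inv_sq hz.1 hz.2).continuousAt.continuousWithinAt

/-- The path integral of `1 / u²` between two points of a ball in the upper half-plane is the
difference of the values of a primitive on that ball. -/
lemma isPathIntegral (hu : HasInflectionZeros u) {a b : ℂ}
    (ha0 : u a ≠ 0) (hb0 : u b ≠ 0) {c : ℂ} {r : ℝ}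
    (hH : ∀ z ∈ Metric.closedBall c r, 0 < z.im) {H : ℂ → ℂ}
    (hprim : ∀ z ∈ Metric.ball c r, u z ≠ 0 → HasDerivAt H (u z ^ 2)⁻¹ z)
    (hac : a ∈ Metric.ball c r) (hbc : b ∈ Metric.ball c r) :
    IsPathIntegral (fun z ↦ (u z ^ 2)⁻¹) (regularSet fun z ↦ (u z ^ 2)⁻¹) a b (H b - H a) := by
  rw [hu.regularSet_eq]
  obtain ⟨γ, hγ⟩ := exists_isC1Path Metric.isOpen_ball (convex_ball c r) hu.countable hac hbc
    (fun h ↦ ha0 h.2) (fun h ↦ hb0 h.2)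
  have hγ' : ∀ t ∈ Set.Icc (0 : ℝ) 1, 0 < (γ t).im ∧ u (γ t) ≠ 0 := fun t ht ↦ by
    have h1 := hγ.mem t ht
    have h2 := hH _ (Metric.ball_subset_closedBall h1.1)
    exact ⟨h2, fun h3 ↦ h1.2 ⟨h2, h3⟩⟩
  refine ⟨⟨γ, hγ.contDiff, hγ.source, hγ.target, hγ'⟩, fun δ hδ ↦ ?_⟩
  -- A second disc contains both `γ` and the arbitrary path `δ`. Its primitive gives them equal
  -- integrals, and `γ` also lies in the original disc.
  have hcompact : IsCompact (γ '' Set.Icc 0 1 ∪ δ '' Set.Icc 0 1) :=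
    (isCompact_Icc.image hγ.contDiff.continuous).union
      (isCompact_Icc.image hδ.contDiff.continuous)
  obtain ⟨c', r', hH', hsub⟩ := exists_ball_supset hcompact (by
    rintro _ (⟨t, ht, rfl⟩ | ⟨t, ht, rfl⟩)
    · exact (hγ' t ht).1
    · exact (hδ.mem t ht).1)
  obtain ⟨H', hprim', -⟩ := hu.exists_primitive hH'
  have key : ∀ {c r} {H : ℂ → ℂ} {γ}, (∀ z ∈ Metric.ball c r, u z ≠ 0 →
      HasDerivAt H (u z ^ 2)⁻¹ z) → (∀ t ∈ Set.Icc (0 : ℝ) 1, γ t ∈ Metric.ball c r) →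
      IsC1Path {z | 0 < z.im ∧ u z ≠ 0} a b γ →
      ∫ t in (0 : ℝ)..1, (u (γ t) ^ 2)⁻¹ * deriv γ t = H b - H a := fun {c r _ γ} h1 h2 h3 ↦
    integral_path_eq_sub (F := fun z ↦ (u z ^ 2)⁻¹)
      (V := {z | 0 < z.im ∧ u z ≠ 0} ∩ Metric.ball c r)
      (hu.continuousOn_inv_sq.mono Set.inter_subset_left)
      (fun z hz ↦ h1 z hz.2 hz.1.2)
      ⟨h3.contDiff, h3.source, h3.target, fun t ht ↦ ⟨h3.mem t ht, h2 t ht⟩⟩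
  have hγC : IsC1Path {z | 0 < z.im ∧ u z ≠ 0} a b γ :=
    ⟨hγ.contDiff, hγ.source, hγ.target, hγ'⟩
  rw [key hprim' (fun t ht ↦ hsub (.inr ⟨t, ht, rfl⟩)) hδ,
    ← key hprim' (fun t ht ↦ hsub (.inl ⟨t, ht, rfl⟩)) hγC,
    key hprim (fun t ht ↦ (hγ.mem t ht).1) hγC]

lemma pathIntegral_eq {g : ℂ → ℂ} {U : Set ℂ} {a b v : ℂ} (hv : IsPathIntegral g U a b v) :
    pathIntegral g U a b = v := by
  have hex : ∃ v, IsPathIntegral g U a b v := ⟨v, hv⟩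
  rw [pathIntegral, dif_pos hex]
  obtain ⟨γ, hγ⟩ := hv.1
  rw [← hex.choose_spec.2 γ hγ, hv.2 γ hγ]

/-- Near every point of the upper half-plane, the path integral of `1 / u²` agrees off the poles
with a meromorphic primitive. -/
lemma exists_local_primitive (hu : HasInflectionZeros u) {a b : ℂ} (ha : 0 < a.im)
    (ha0 : u a ≠ 0) (hb : 0 < b.im) :
    ∃ H : ℂ → ℂ, MeromorphicAt H b ∧ (u b ≠ 0 → HasDerivAt H (u b ^ 2)⁻¹ b) ∧
      ∀ᶠ z in 𝓝 b, u z ≠ 0 → IsPathIntegral (fun z ↦ (u z ^ 2)⁻¹)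
        (regularSet fun z ↦ (u z ^ 2)⁻¹) a z (H z) := by
  obtain ⟨c, r, hH, hsub⟩ := exists_ball_supset (K := {a, b}) (Set.toFinite _).isCompact
    (by rintro z (rfl | rfl) <;> assumption)
  obtain ⟨H, hprim, hmer⟩ := hu.exists_primitive hH
  have hac : a ∈ Metric.ball c r := hsub (by simp)
  have hbc : b ∈ Metric.ball c r := hsub (by simp)
  refine ⟨fun z ↦ H z - H a, (hmer b hbc).sub (.const _ _),
    fun hb0 ↦ (hprim b hbc hb0).sub_const _, ?_⟩
  filter_upwards [Metric.isOpen_ball.mem_nhds hbc] with z hz hz0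
  exact hu.isPathIntegral ha0 hz0 hH hprim hac hz

/-- The function `b ↦ ∫_a^b dz / u(z)²`. -/
def primitive (u : ℂ → ℂ) (a : ℂ) : ℂ → ℂ :=
  pathIntegral (fun z ↦ (u z ^ 2)⁻¹) (regularSet fun z ↦ (u z ^ 2)⁻¹) a

variable {a : ℂ}

lemma isPathIntegral_primitive (hu : HasInflectionZeros u) (ha : 0 < a.im) (ha0 : u a ≠ 0)
    {b : ℂ} (hb : 0 < b.im) (hb0 : u b ≠ 0) :
    IsPathIntegral (fun z ↦ (u z ^ 2)⁻¹) (regularSet fun z ↦ (u z ^ 2)⁻¹) a b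
      (primitive u a b) := by
  obtain ⟨H, -, -, h⟩ := hu.exists_local_primitive ha ha0 hb
  have h1 := h.self_of_nhds hb0
  rwa [primitive, pathIntegral_eq h1]

lemma hasDerivAt_primitive (hu : HasInflectionZeros u) (ha : 0 < a.im) (ha0 : u a ≠ 0)
    {b : ℂ} (hb : 0 < b.im) (hb0 : u b ≠ 0) :
    HasDerivAt (primitive u a) (u b ^ 2)⁻¹ b := by
  obtain ⟨H, -, hd, h⟩ := hu.exists_local_primitive ha ha0 hb
  refine (hd hb0).congr_of_eventuallyEq ?_
  filter_upwards [h, (hu.analyticAt b hb).continuousAt.eventually_ne hb0] with z hz hz0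
  exact pathIntegral_eq (hz hz0)

lemma meromorphicAt_primitive (hu : HasInflectionZeros u) (ha : 0 < a.im) (ha0 : u a ≠ 0)
    {b : ℂ} (hb : 0 < b.im) : MeromorphicAt (primitive u a) b := by
  obtain ⟨H, hm, -, h⟩ := hu.exists_local_primitive ha ha0 hb
  refine hm.congr ?_
  filter_upwards [h.filter_mono nhdsWithin_le_nhds, hu.eventually_ne_zero hb] with z hz hz0
  exact (pathIntegral_eq (hz hz0)).symm

/-- If `h' = 1 / u²`, then `h'' / h' = -2 u' / u`, and the squares of `u' / u` cancel. -/
lemma schwarz_primitive (hu : HasInflectionZeros u) (ha : 0 < a.im) (ha0 : u a ≠ 0)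
    {b : ℂ} (hb : 0 < b.im) (hb0 : u b ≠ 0) :
    schwarz (primitive u a) b = -2 * deriv (deriv u) b / u b := by
  have hev : ∀ᶠ z in 𝓝 b, 0 < z.im ∧ u z ≠ 0 :=
    (isOpen_upperHalfPlaneSet.eventually_mem hb).and
      ((hu.analyticAt b hb).continuousAt.eventually_ne hb0)
  have h1 : ∀ z, 0 < z.im ∧ u z ≠ 0 → deriv (primitive u a) z = (u z ^ 2)⁻¹ := fun z hz ↦
    (hu.hasDerivAt_primitive ha ha0 hz.1 hz.2).deriv
  have h2 : ∀ z, 0 < z.im ∧ u z ≠ 0 →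
      deriv (deriv (primitive u a)) z = -(2 * u z * deriv u z) / (u z ^ 2) ^ 2 := fun z hz ↦ by
    have h3 : deriv (primitive u a) =ᶠ[𝓝 z] fun z ↦ (u z ^ 2)⁻¹ := by
      filter_upwards [isOpen_upperHalfPlaneSet.mem_nhds hz.1,
        (hu.analyticAt z hz.1).continuousAt.eventually_ne hz.2] with w hw hw'
      exact h1 w ⟨hw, hw'⟩
    rw [h3.deriv_eq]
    refine (((hu.analyticAt z hz.1).differentiableAt.hasDerivAt.pow 2).inv
      (pow_ne_zero 2 hz.2)).deriv.trans ?_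
    simp
  have h3 : (fun z ↦ deriv (deriv (primitive u a)) z / deriv (primitive u a) z) =ᶠ[𝓝 b]
      fun z ↦ -2 * (deriv u z / u z) := by
    filter_upwards [hev] with z hz
    have := hz.2
    rw [h1 z hz, h2 z hz]
    field_simp
  have h4 : HasDerivAt (fun z ↦ -2 * (deriv u z / u z))
      (-2 * ((deriv (deriv u) b * u b - deriv u b * deriv u b) / u b ^ 2)) b :=
    ((hu.analyticAt b hb).deriv.differentiableAt.hasDerivAt.div
      (hu.analyticAt b hb).differentiableAt.hasDerivAt hb0).const_mul _
  have h5 := h3.self_of_nhds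
  dsimp only at h5
  rw [schwarz, h3.deriv_eq, h4.deriv, h5]
  field_simp
  ring

end HasInflectionZeros

end ModularSchwarz
end

noncomputable section

namespace ModularSchwarz

open Filter UpperHalfPlane
open ModularForm (eta E₄ E₆)

variable {n : ℕ} {x : Fin n → ℝ}

/-! ### Zeros of `y` -/

lemma eventually_ne_zero_of_deriv_ne_zero {u : ℂ → ℂ} {p : ℂ} (h0 : u p = 0)
    (h1 : deriv u p ≠ 0) : ∀ᶠ z in 𝓝[≠] p, u z ≠ 0 := by
  have h := (differentiableAt_of_deriv_ne_zero h1).hasDerivAt.eventually_ne h1 (c := u p)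
  rwa [h0] at h

/-- The differential equation holds off the zeros, which are isolated; by continuity it extends to
them, and its right side vanishes there. -/
lemma deriv_deriv_y_of_eq_zero (hx : ∀ i, x i ∈ Set.Ioo (0 : ℝ) 1) (hsol : IsSolution 8 3 12 x)
    {τ : ℍ} (h : y x τ = 0) : deriv (deriv (y x)) τ = 0 := by
  have h1 : ∀ᶠ z in 𝓝[≠] (τ : ℂ), deriv (deriv (y x)) z =
      -(Real.pi : ℂ) ^ 2 * ((12 * (n : ℂ) + 5) / 6) ^ 2 * E4 z * y x z := by
    filter_upwards [eventually_ne_zero_of_deriv_ne_zero h (deriv_y_ne_zero hx hsol.ne_of_ne h),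
      nhdsWithin_le_nhds (isOpen_upperHalfPlaneSet.mem_nhds τ.2)] with z hz him
    exact deriv_deriv_y hsol (τ := ⟨z, him⟩) hz
  have h2 : Tendsto (deriv (deriv (y x))) (𝓝[≠] (τ : ℂ)) (𝓝 (deriv (deriv (y x)) τ)) :=
    (analyticAt_y τ).deriv.deriv.continuousAt.tendsto.mono_left nhdsWithin_le_nhds
  have h3 : Tendsto (fun z ↦ -(Real.pi : ℂ) ^ 2 * ((12 * (n : ℂ) + 5) / 6) ^ 2 * E4 z * y x z)
      (𝓝[≠] (τ : ℂ))
      (𝓝 (-(Real.pi : ℂ) ^ 2 * ((12 * (n : ℂ) + 5) / 6) ^ 2 * E4 τ * y x τ)) :=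
    ((tendsto_const_nhds.mul (analyticAt_E4 τ).continuousAt.tendsto).mul
      (analyticAt_y τ).continuousAt.tendsto).mono_left nhdsWithin_le_nhds
  rw [tendsto_nhds_unique h2 (h3.congr' (h1.mono fun z hz ↦ hz.symm)), h, mul_zero]

lemma hasInflectionZeros_y (hx : ∀ i, x i ∈ Set.Ioo (0 : ℝ) 1) (hsol : IsSolution 8 3 12 x)
    {w : Fin n → ℍ} (hw : ∀ i, J (w i : ℂ) = (x i : ℂ)) : HasInflectionZeros (y x) where
  analyticAt z hz := analyticAt_y ⟨z, hz⟩
  deriv_ne_zero z hz h := deriv_y_ne_zero hx hsol.ne_of_ne (τ := ⟨z, hz⟩) h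
  deriv_deriv z hz h := deriv_deriv_y_of_eq_zero hx hsol (τ := ⟨z, hz⟩) h
  countable := by
    refine ((countable_poleSet w).image ((↑) : ℍ → ℂ)).mono ?_
    rintro z ⟨hz, hz0⟩
    exact ⟨⟨z, hz⟩, (y_eq_zero_iff_mem_poleSet hx hw ⟨z, hz⟩).mp hz0, rfl⟩

/-- `S` fixes `i`, and `i⁶ = -1`. -/
lemma E6_I : E6 UpperHalfPlane.I = 0 := by
  have h := congrFun (slash_modularForm E₆ ModularGroup.S) UpperHalfPlane.I
  have hS : ModularGroup.S • UpperHalfPlane.I = UpperHalfPlane.I := by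
    apply UpperHalfPlane.ext
    rw [UpperHalfPlane.modular_S_smul]
    simp
  rw [ModularForm.SL_slash_apply, ModularGroup.denom_S, hS, coe_I, zpow_neg,
    show (Complex.I ^ (6 : ℤ)) = -1 by
      rw [show (6 : ℤ) = (6 : ℕ) from rfl, zpow_natCast, show 6 = 4 + 2 from rfl, pow_add,
        Complex.I_pow_four, Complex.I_sq, one_mul]] at h
  rw [E6_coe]
  norm_num at h
  linear_combination (-1 / 2 : ℂ) * h

/-- `J(i) = 1` lies outside `{0} ∪ (0, 1)`, so the base point of the integral is not a pole. -/
lemma y_I_ne_zero (hx : ∀ i, x i ∈ Set.Ioo (0 : ℝ) 1) : y x Complex.I ≠ 0 := by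
  have hJ : J UpperHalfPlane.I = 1 := (J_eq_one_iff _).mpr E6_I
  rw [← coe_I, Ne, y_eq_zero_iff, ← J_eq_zero_iff, hJ]
  rintro (h | ⟨i, hi⟩)
  · exact one_ne_zero h
  · exact (hx i).2.ne' (by exact_mod_cast hi)

/-! ### The character -/

/-- The automorphy factor of `η²⁰`, up to `(cτ + d)¹⁰`. -/
def etaFactor (γ : SL(2, ℤ)) (τ : ℍ) : ℂ :=
  eta ((γ • τ : ℍ) : ℂ) ^ 20 / (denom (γ : GL (Fin 2) ℝ) τ ^ 10 * eta τ ^ 20)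

/-- `(η²⁰)⁶ = (η²⁴)⁵`, and `η²⁴` is modular with trivial character. -/
lemma etaFactor_pow (γ : SL(2, ℤ)) (τ : ℍ) : etaFactor γ τ ^ 6 = 1 := by
  have h1 := denom_ne_zero (γ : GL (Fin 2) ℝ) τ
  have h2 := eta_ne_zero τ
  rw [etaFactor, div_pow, div_eq_one_iff_eq (by positivity), ← pow_mul, pow_mul _ 24 5,
    eta_pow_smul]
  ring

lemma continuous_eta : Continuous fun τ : ℍ ↦ eta τ :=
  continuous_iff_continuousAt.mpr fun τ ↦
    (analyticAt_eta τ).continuousAt.comp continuous_coe.continuousAt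

lemma continuous_etaFactor (γ : SL(2, ℤ)) : Continuous (etaFactor γ) := by
  have h1 : Continuous fun τ : ℍ ↦ denom (γ : GL (Fin 2) ℝ) τ := by
    simp only [ModularGroup.denom_apply]
    fun_prop
  have h2 : Continuous fun τ : ℍ ↦ γ • τ := continuous_const_smul (γ : GL (Fin 2) ℝ)
  exact ((continuous_eta.comp h2).pow 20).div ((h1.pow 10).mul (continuous_eta.pow 20))
    fun τ ↦ mul_ne_zero (pow_ne_zero _ (denom_ne_zero _ τ)) (eta_pow_ne_zero τ 20)

/-- A continuous function on a connected space with values in the finite set of sixth roots of unity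
is constant. -/
lemma etaFactor_eq (γ : SL(2, ℤ)) (τ σ : ℍ) : etaFactor γ τ = etaFactor γ σ := by
  have hfin : {z : ℂ | z ^ 6 = 1}.Finite := by
    refine (Polynomial.nthRootsFinset 6 (1 : ℂ)).finite_toSet.subset fun z hz ↦ ?_
    exact (Polynomial.mem_nthRootsFinset (by norm_num) 1).mpr hz
  exact isPreconnected_univ.constant_of_mapsTo hfin.isDiscrete
    (continuous_etaFactor γ).continuousOn (fun τ _ ↦ etaFactor_pow γ τ) trivial trivial

lemma etaFactor_mul (γ δ : SL(2, ℤ)) (τ : ℍ) :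
    etaFactor (γ * δ) τ = etaFactor γ (δ • τ) * etaFactor δ τ := by
  have h1 := denom_ne_zero (γ : GL (Fin 2) ℝ) (δ • τ)
  have h2 := denom_ne_zero (δ : GL (Fin 2) ℝ) τ
  have h3 := eta_ne_zero τ
  have h4 := eta_ne_zero (δ • τ)
  have h5 : denom ((γ * δ : SL(2, ℤ)) : GL (Fin 2) ℝ) τ =
      denom (γ : GL (Fin 2) ℝ) ((δ • τ : ℍ) : ℂ) * denom (δ : GL (Fin 2) ℝ) τ := by
    rw [map_mul, map_mul, denom_cocycle _ _ τ.im_ne_zero, ← coe_smul_of_det_pos (by simp)]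
    rfl
  simp only [etaFactor, mul_smul, h5]
  field_simp

/-- The character of `η²⁰`. -/
def etaChar : SL(2, ℤ) →* ℂˣ :=
  MonoidHom.mk' (fun γ ↦ Units.mk0 (etaFactor γ UpperHalfPlane.I) fun h ↦ by
    simpa [h] using etaFactor_pow γ UpperHalfPlane.I) fun γ δ ↦ by
      ext
      simp only [Units.val_mk0, Units.val_mul, etaFactor_mul]
      rw [etaFactor_eq γ]

lemma eta_pow_twenty_smul (γ : SL(2, ℤ)) (τ : ℍ) : eta ((γ • τ : ℍ) : ℂ) ^ 20 =
    (etaChar γ : ℂ) * denom (γ : GL (Fin 2) ℝ) τ ^ 10 * eta τ ^ 20 := by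
  have h1 : (etaChar γ : ℂ) = etaFactor γ τ := etaFactor_eq γ _ _
  rw [h1, etaFactor, mul_assoc, div_mul_cancel₀]
  exact mul_ne_zero (pow_ne_zero _ (denom_ne_zero _ τ)) (eta_pow_ne_zero τ 20)

lemma f_smul (γ : SL(2, ℤ)) (τ : ℍ) : f x ((γ • τ : ℍ) : ℂ) =
    (etaChar γ : ℂ) * denom (γ : GL (Fin 2) ℝ) τ ^ (2 : ℤ) * f x τ := by
  have h1 := denom_ne_zero (γ : GL (Fin 2) ℝ) τ
  simp only [f, eta_pow_twenty_smul, E4_smul, J_smul]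
  rw [zpow_ofNat, mul_pow, ← pow_mul, mul_assoc (_ ^ (4 * 2)),
    show (10 : ℕ) = 2 + 4 * 2 from rfl, pow_add]
  generalize E4 τ ^ 2 * ∏ i, (J τ - (x i : ℂ)) ^ 2 = d
  rw [← mul_assoc (etaChar γ : ℂ), mul_right_comm, mul_comm (_ * _) (denom _ _ ^ (4 * 2)),
    mul_div_mul_left _ _ (pow_ne_zero _ h1), mul_div_assoc]

/-! ### Behaviour at the cusp -/

/-- `f` as a function of `exp (2πiτ / 6)`. -/
def fCusp (x : Fin n → ℝ) (r : ℂ) : ℂ :=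
  r ^ 5 * eulerProd (r ^ 6) ^ 20 /
    (cuspFunction 1 E₄ (r ^ 6) ^ 2 * ∏ i, ((Jinvq (r ^ 6))⁻¹ - (x i : ℂ)) ^ 2)

/-- `η²⁰` begins with `q^(5/6)`, which dictates the parameter `exp (2πiτ / 6)` and the factor `r ^
5`. -/
lemma f_eq_fCusp (τ : ℍ) :
    f x τ = fCusp x (Complex.exp (2 * Real.pi * Complex.I * τ / (6 : ℕ))) := by
  have h1 : Complex.exp (2 * Real.pi * Complex.I * τ / (6 : ℕ)) ^ 6 =
      Function.Periodic.qParam 1 τ := by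
    rw [← Complex.exp_nat_mul, Function.Periodic.qParam]
    congr 1
    push_cast
    ring
  have h2 : Complex.exp (2 * Real.pi * Complex.I * τ / (6 : ℕ)) ^ 5 =
      Function.Periodic.qParam 24 τ ^ 20 := by
    rw [Function.Periodic.qParam, ← Complex.exp_nat_mul, ← Complex.exp_nat_mul]
    congr 1
    push_cast
    ring
  rw [fCusp, h1, h2, ← J_eq_inv, cuspFunction_E₄_qParam, ← mul_pow, ← eta_eq, f]

lemma analyticAt_Jinvq : AnalyticAt ℂ Jinvq 0 :=
  ((analyticAt_const.mul analyticAt_id).mul ((analyticAt_eulerProd (by simp)).pow 24)).div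
    (analyticAt_cuspFunction_E₄.pow 3) (by simp [cuspFunction_E₄_zero])

lemma meromorphicAt_fCusp : MeromorphicAt (fCusp x) 0 := by
  have hcomp : ∀ {g : ℂ → ℂ}, AnalyticAt ℂ g 0 → AnalyticAt ℂ (fun r ↦ g (r ^ 6)) 0 :=
    fun {g} hg ↦ hg.comp_of_eq (analyticAt_id.pow 6) (by simp)
  have h1 := hcomp (analyticAt_eulerProd (q := 0) (by simp))
  have h2 := hcomp analyticAt_cuspFunction_E₄
  have h3 := hcomp analyticAt_Jinvq
  exact ((analyticAt_id.pow 5).mul (h1.pow 20)).meromorphicAt.div ((h2.pow 2).meromorphicAt.mul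
    (MeromorphicAt.fun_prod fun i _ ↦ (h3.meromorphicAt.inv.sub (.const (x i : ℂ) 0)).pow 2))

lemma isMeromorphicModularForm_f (x : Fin n → ℝ) :
    IsMeromorphicModularForm 2 etaChar (f x) where
  meromorphic τ := by
    rw [f_eq_inv]
    exact ((analyticAt_y τ).meromorphicAt.pow 2).inv
  transform := f_smul
  cusp := ⟨6, by norm_num, fCusp x, meromorphicAt_fCusp, .of_forall f_eq_fCusp⟩

lemma tendsto_eta_atImInfty : Tendsto (fun τ : ℍ ↦ eta τ) atImInfty (𝓝 0) := by
  have h1 := (analyticAt_eulerProd (q := 0) (by simp)).continuousAt.tendsto.comp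
    (qParam_tendsto_atImInfty one_pos)
  have h2 := (qParam_tendsto_atImInfty (h := 24) (by norm_num)).mul h1
  rw [zero_mul] at h2
  exact h2

/-- At the cusp `η` and each `1 / (J - xᵢ)` tend to `0`, while `E₄` tends to `1`. -/
lemma isBoundedAtImInfty_f (x : Fin n → ℝ) : IsBoundedAtImInfty fun τ : ℍ ↦ f x τ := by
  have h1 : ∀ i, Tendsto (fun τ : ℍ ↦ (J τ - (x i : ℂ))⁻¹) atImInfty (𝓝 0) := fun i ↦
    tendsto_inv₀_cobounded.comp
      ((tendsto_sub_const_cobounded (x i : ℂ)).comp tendsto_J_atImInfty)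
  have h2 := ((tendsto_eta_atImInfty.pow 20).mul ((tendsto_E₄.inv₀ one_ne_zero).pow 2)).mul
    (tendsto_finsetProd Finset.univ fun i _ ↦ (h1 i).pow 2)
  refine (h2.congr fun τ ↦ ?_).isBigO_one ℝ
  rw [f, div_eq_mul_inv, mul_inv, ← Finset.prod_inv_distrib, E4_coe]
  simp only [inv_pow, mul_assoc]

end ModularSchwarz
end

/-! ### The main theorem -/

open Filter UpperHalfPlane ModularSchwarz in
theorem theorem3p2 (n : ℕ) (x : Fin n → ℝ) (hx : ∀ i, x i ∈ Set.Ioo (0 : ℝ) 1)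
    (hsol : IsSolution 8 3 12 x)
    (w : Fin n → ℍ) (hw : ∀ i, J (w i : ℂ) = (x i : ℂ)) :
    -- weight 2 modular form with a character, holomorphic at the cusp
    (∃ χ : SL(2, ℤ) →* ℂˣ, IsMeromorphicModularForm 2 χ (f x)) ∧
    IsBoundedAtImInfty (fun τ : ℍ => f x (τ : ℂ)) ∧
    -- double poles with zero residues, exactly at the points equivalent to `ρ` or to some `w i`
    (∀ τ ∈ poleSet w, meromorphicOrderAt (f x) (τ : ℂ) = -2 ∧ HasResidueAt (f x) (τ : ℂ) 0) ∧
    -- holomorphic and nonvanishing elsewhere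
    (∀ τ ∉ poleSet w, AnalyticAt ℂ (f x) (τ : ℂ) ∧ f x (τ : ℂ) ≠ 0) ∧
    -- the integral of `f x` from `i` is well defined off the poles, and is a meromorphic
    -- primitive of `f x`
    (∀ τ ∉ poleSet w,
      IsPathIntegral (f x) (regularSet (f x)) Complex.I (τ : ℂ) (h x (τ : ℂ)) ∧
      HasDerivAt (h x) (f x (τ : ℂ)) (τ : ℂ)) ∧
    (∀ τ : ℍ, MeromorphicAt (h x) (τ : ℂ)) ∧
    -- its Schwarz derivative, off the poles and, by continuation, at every point
    (∀ τ ∉ poleSet w, schwarz (h x) (τ : ℂ)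
      = 2 * (Real.pi : ℂ) ^ 2 * ((12 * (n : ℂ) + 5) / 6) ^ 2 * ModularForm.E₄ τ) ∧
    (∀ τ : ℍ, Tendsto (schwarz (h x)) (𝓝[≠] (τ : ℂ))
      (𝓝 (2 * (Real.pi : ℂ) ^ 2 * ((12 * (n : ℂ) + 5) / 6) ^ 2 * ModularForm.E₄ τ))) := by
  have hu := hasInflectionZeros_y hx hsol hw
  have hI : 0 < Complex.I.im := by simp
  have hI0 := y_I_ne_zero hx
  have hh : h x = HasInflectionZeros.primitive (y x) Complex.I := by
    rw [h, f_eq_inv, HasInflectionZeros.primitive]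
  have hpole := y_eq_zero_iff_mem_poleSet hx hw
  have hschwarz : ∀ τ : ℍ, y x τ ≠ 0 → schwarz (h x) τ =
      2 * (Real.pi : ℂ) ^ 2 * ((12 * (n : ℂ) + 5) / 6) ^ 2 * E4 τ := fun τ hτ ↦ by
    rw [hh, hu.schwarz_primitive hI hI0 τ.2 hτ, deriv_deriv_y hsol hτ, div_eq_iff hτ]
    ring
  refine ⟨⟨etaChar, isMeromorphicModularForm_f x⟩, isBoundedAtImInfty_f x, fun τ hτ ↦ ?_,
    fun τ hτ ↦ ?_, fun τ hτ ↦ ?_, fun τ ↦ ?_, fun τ hτ ↦ ?_, fun τ ↦ ?_⟩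
  · rw [← hpole] at hτ
    rw [f_eq_inv]
    exact ⟨hu.meromorphicOrderAt_eq τ.2 hτ, hu.hasResidueAt τ.2 hτ⟩
  · rw [← hpole] at hτ
    rw [f_eq_inv]
    exact ⟨hu.analyticAt_inv_sq τ.2 hτ, inv_ne_zero (pow_ne_zero 2 hτ)⟩
  · rw [← hpole] at hτ
    rw [hh, f_eq_inv]
    exact ⟨hu.isPathIntegral_primitive hI hI0 τ.2 hτ, hu.hasDerivAt_primitive hI hI0 τ.2 hτ⟩
  · rw [hh]
    exact hu.meromorphicAt_primitive hI hI0 τ.2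
  · rw [← hpole] at hτ
    rw [hschwarz τ hτ, E4_coe]
  -- The formula holds on a punctured neighbourhood of every point, and its right side is
  -- continuous.
  · rw [← E4_coe]
    refine ((tendsto_const_nhds.mul (analyticAt_E4 τ).continuousAt.tendsto).mono_left
      nhdsWithin_le_nhds).congr' ?_
    filter_upwards [hu.eventually_ne_zero τ.2,
      nhdsWithin_le_nhds (isOpen_upperHalfPlaneSet.mem_nhds τ.2)] with z hz him
    exact (hschwarz ⟨z, him⟩ hz).symm
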